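/- Consider a real RAM: memory cells, addressed directly or indirectly, hold real numbers, and each of the following takes one step: $+,-,\times,/$, the floor function, loading an integer constant, reading or writing a cell, comparing two cells, appending a point to a write-only output, and a line query, which, for a given line (a point and a nonzero direction), reports whether it meets the input disk $D$ and, if so, the two endpoints of its intersection with $D$. The input is a closed disk $D\subset\mathbb R^2$, given by the real coordinates of its center and its real radius $r>0$. The discrete hull of $D$ is the convex polygon $D^0=\operatorname{conv}(D\cap\mathbb Z^2)$ (possibly empty, a point or a segment). There is a single program which, for every such disk $D$, halts after outputting the vertices of $D^0$, each exactly once, in counterclockwise order. It runs in $O(r^{2/3}\log r)$ time and $O(1)$ space: there are absolute constants $K$ and $S$ such that on every disk of radius $r>0$ it takes at most $K\,\rho^{2/3}\log\rho$ steps, where $\rho=\max(r,2)$, and accesses at most $S$ memory cells (the output is not counted). -/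

import Mathlib

/-- The Euclidean plane. -/
abbrev Plane : Type := EuclideanSpace ℝ (Fin 2)

/-- The integer lattice `ℤ × ℤ` in the plane. -/
def integerLattice : Set Plane :=
  {p | ∀ i, ∃ n : ℤ, p i = (n : ℝ)}

/-- The discrete hull of `C`: the convex hull of the lattice points contained in `C`. -/
def discreteHull (C : Set Plane) : Set Plane :=
  convexHull ℝ (C ∩ integerLattice)

/-- The planar cross product (the determinant of the pair `u, v`). -/
def planarCross (u v : Plane) : ℝ :=
  u 0 * v 1 - u 1 * v 0

/-- `L` lists the vertices of the convex polygon `H`, each of them exactly once, in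
counterclockwise order: along every edge from a listed vertex to its (cyclic) successor, the whole
of `H` lies on the left of the edge or on its supporting line. The polygon may be empty, a point,
or a segment; the starting vertex is arbitrary. -/
def IsCCWVertexList (H : Set Plane) (L : List Plane) : Prop :=
  L.Nodup ∧
  {p | p ∈ L} = H.extremePoints ℝ ∧
  ∀ i : Fin L.length, ∀ q ∈ H,
    0 ≤ planarCross
      (L[(i.val + 1) % L.length]'(Nat.mod_lt _ (Nat.lt_of_le_of_lt (Nat.zero_le _) i.isLt))
        - L[i.val])
      (q - L[i.val])

/-! ### A real RAM with floor function and line queries against a planar body -/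

namespace RealRAM

/-- A memory state: cells indexed by `ℕ`, each holding a real number; the write-only output
produced so far, in order; and the set of memory cells that have been accessed so far. -/
structure State where
  mem : ℕ → ℝ
  out : List Plane
  used : Finset ℕ

/-- The elementary instructions; the arguments that are natural numbers are addresses of cells, the
first one being the target, unless another meaning is given. The only numerical constants
in a program are integers. -/
inductive Instr where
  | const (i : ℕ) (z : ℤ)
  | add (i j k : ℕ)
  | sub (i j k : ℕ)
  | mul (i j k : ℕ)
  | div (i j k : ℕ)
  | floor (i j : ℕ)
  /-- Indirect read: cell `i` receives the content of the cell whose address is in cell `j`. -/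
  | load (i j : ℕ)
  /-- Indirect write: the cell whose address is in cell `i` receives the content of cell `j`. -/
  | store (i j : ℕ)
  /-- Line query: intersect the body with the line through the point stored in cells `px, py`
  whose direction is the vector stored in cells `dx, dy`. Cell `h` receives `1` or `0` according to
  whether they meet; if they do, then the two endpoints of the intersection, in the order in
  which the directed line passes them, are written to the cells `a0, a1` and `b0, b1`. -/
  | line (h a0 a1 b0 b1 px py dx dy : ℕ)
  /-- Append the point whose coordinates are in cells `i, j` to the output. -/
  | emit (i j : ℕ)

/-- The parameters `t` for which `p + t • d` lies in the body `C`; there are none if `d = 0`, as no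
line is determined then. -/
def lineParams (C : Set Plane) (p d : Plane) : Set ℝ :=
  {t | d ≠ 0 ∧ p + t • d ∈ C}

/-- Write the value `x` to cell `i`. -/
def write (i : ℕ) (x : ℝ) (m : ℕ → ℝ) : ℕ → ℝ :=
  Function.update m i x

/-- The point whose coordinates are stored in the cells `i` and `j`. -/
noncomputable def pointAt (m : ℕ → ℝ) (i j : ℕ) : Plane :=
  !₂[m i, m j]

open Classical in
/-- The memory after an instruction, when line queries are against the body `C`. -/
noncomputable def Instr.newMem (C : Set Plane) (m : ℕ → ℝ) : Instr → (ℕ → ℝ)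
  | .const i z => write i (z : ℝ) m
  | .add i j k => write i (m j + m k) m
  | .sub i j k => write i (m j - m k) m
  | .mul i j k => write i (m j * m k) m
  | .div i j k => write i (m j / m k) m
  | .floor i j => write i ((⌊m j⌋ : ℤ) : ℝ) m
  | .load i j => write i (m ⌊m j⌋₊) m
  | .store i j => write ⌊m i⌋₊ (m j) m
  | .line h a0 a1 b0 b1 px py dx dy =>
      let p := pointAt m px py
      let d := pointAt m dx dy
      let T := lineParams C p d
      if T.Nonempty then
        let a := p + sInf T • d
        let b := p + sSup T • d
        write b1 (b 1) (write b0 (b 0) (write a1 (a 1) (write a0 (a 0) (write h 1 m))))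
      else write h 0 m
  | .emit _ _ => m

/-- The memory cells that an instruction accesses (reads or writes), in memory `m`. -/
noncomputable def Instr.cells (m : ℕ → ℝ) : Instr → Finset ℕ
  | .const i _ => {i}
  | .add i j k => {i, j, k}
  | .sub i j k => {i, j, k}
  | .mul i j k => {i, j, k}
  | .div i j k => {i, j, k}
  | .floor i j => {i, j}
  | .load i j => {i, j, ⌊m j⌋₊}
  | .store i j => {i, j, ⌊m i⌋₊}
  | .line h a0 a1 b0 b1 px py dx dy => {h, a0, a1, b0, b1, px, py, dx, dy}
  | .emit i j => {i, j}

/-- The points that an instruction appends to the output. -/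
noncomputable def Instr.newOut (m : ℕ → ℝ) : Instr → List Plane
  | .emit i j => [pointAt m i j]
  | _ => []

/-- Execution of one elementary instruction. -/
noncomputable def Instr.exec (C : Set Plane) (a : Instr) (s : State) : State where
  mem := a.newMem C s.mem
  out := s.out ++ a.newOut s.mem
  used := s.used ∪ a.cells s.mem

/-- Programs. The tests compare the contents of two cells: `branch i j P Q` runs `P` if
`mem i ≤ mem j` and `Q` otherwise; `loop i j P` repeats `P` as long as `mem i ≤ mem j`. -/
inductive Prog where
  | skip
  | instr (a : Instr)
  | seq (P Q : Prog)
  | branch (i j : ℕ) (P Q : Prog)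
  | loop (i j : ℕ) (P : Prog)

/-- The state after a comparison of cells `i` and `j`: both count as accessed. -/
def touch (i j : ℕ) (s : State) : State :=
  { s with used := s.used ∪ {i, j} }

/-- `Exec C P s t s'`: with line queries against the body `C`, the program `P` started in state `s`
halts in state `s'` after exactly `t` steps, where each elementary instruction and each
evaluation of a test is one step. -/
inductive Exec (C : Set Plane) : Prog → State → ℕ → State → Prop where
  | skip (s : State) : Exec C .skip s 0 s
  | instr (a : Instr) (s : State) : Exec C (.instr a) s 1 (a.exec C s)
  | seq {P Q : Prog} {s₁ s₂ s₃ : State} {t₁ t₂ : ℕ} :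
      Exec C P s₁ t₁ s₂ → Exec C Q s₂ t₂ s₃ → Exec C (.seq P Q) s₁ (t₁ + t₂) s₃
  | branch_true {i j : ℕ} {P Q : Prog} {s s' : State} {t : ℕ} :
      s.mem i ≤ s.mem j → Exec C P (touch i j s) t s' → Exec C (.branch i j P Q) s (t + 1) s'
  | branch_false {i j : ℕ} {P Q : Prog} {s s' : State} {t : ℕ} :
      ¬ s.mem i ≤ s.mem j → Exec C Q (touch i j s) t s' → Exec C (.branch i j P Q) s (t + 1) s'
  | loop_stop {i j : ℕ} {P : Prog} {s : State} :
      ¬ s.mem i ≤ s.mem j → Exec C (.loop i j P) s 1 (touch i j s)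
  | loop_step {i j : ℕ} {P : Prog} {s s₁ s₂ : State} {t₁ t₂ : ℕ} :
      s.mem i ≤ s.mem j → Exec C P (touch i j s) t₁ s₁ → Exec C (.loop i j P) s₁ t₂ s₂ →
      Exec C (.loop i j P) s (t₁ + t₂ + 1) s₂

/-- The number of memory cells that have been accessed up to the state `s`. -/
def State.space (s : State) : ℕ :=
  s.used.card

/-- The initial state on a disk: cells `0, 1` hold its center, cell `2` its radius, and all other
cells hold `0`; nothing has been output or accessed. -/
def diskInput (c : Plane) (r : ℝ) : State where
  mem
    | 0 => c 0
    | 1 => c 1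
    | 2 => r
    | _ => 0
  out := []
  used := ∅

end RealRAM

/-! The program wraps the hull. Starting from the rightmost lattice point of the lowest nonempty
row, it moves again and again to the far end of the next edge. The edge directions are treated in
four half-open quadrants, each from `a₀` (excluded) to `irot a₀`.

Correctness is local. Every move ends at the last lattice point on a supporting line
(`SupportingStep`). Where two such steps meet, a linear functional that is maximal among the
neighbours is maximal on the whole set (`SupportingStep.le_of_local_max`), and the successor is
determined (`SupportingStep.unique`). Hence a walk of such steps that returns to its start only at
its end lists exactly the vertices (`isCCWVertexList_of_closed_walk`).

The direction of the next edge at `v` comes from a search in the style of Euclid's algorithm. It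
keeps a lattice basis `a, b` with `v + a` outside the disk, `v + b` inside, and every disk direction
of the quadrant strictly to the left of `a` (`SearchInv`). One line query pushes `b` along `a` as
far as the disk allows. A second one finds the least `m ≥ 1` with `v + a + m b` in the disk, and the
basis becomes `a + (m - 1) b, a + m b`; if there is no such `m`, then `b` is the edge direction
(`SearchInv.supports`). The maximal push forces `m ≥ 2`, so each round at least quadruples the
squared length of `b` (`SearchInv.idot_step`). That squared length is at most `4 r²`, which leaves
`O(log r)` rounds.

The edges in one quadrant are distinct lattice vectors whose ℓ¹ norms sum to at most `4 r`. At most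
`(s + 1)²` of them have norm at most `s`, and at most `4 r / s` are longer; `s` of order `r^(1/3)`
gives `O(r^(2/3))` edges (`length_le_of_isChain_quadrantStep`). Space is constant because no
indirect addressing is used. -/

/-! ### Supporting steps and vertex lists in the plane. -/

/-- The planar dot product. -/
def planarDot (u v : Plane) : ℝ :=
  u 0 * v 0 + u 1 * v 1

/-- The angle from `e` to `w` lies in `(0, π]`. -/
def LeftOf (e w : Plane) : Prop :=
  0 < planarCross e w ∨ planarCross e w = 0 ∧ planarDot e w < 0

theorem LeftOf.cross_nonneg {e w : Plane} (h : LeftOf e w) : 0 ≤ planarCross e w := by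
  rcases h with h | h
  · exact h.le
  · exact h.1.ge

theorem not_leftOf_zero_right (e : Plane) : ¬ LeftOf e 0 := by
  simp [LeftOf, planarCross, planarDot]

theorem not_leftOf_zero_left (w : Plane) : ¬ LeftOf 0 w := by
  simp [LeftOf, planarCross, planarDot]

theorem planarCross_combo (e x y : Plane) (s t : ℝ) :
    planarCross e (s • x + t • y) = s * planarCross e x + t * planarCross e y := by
  simp [planarCross]; ring

theorem planarDot_combo (e x y : Plane) (s t : ℝ) :
    planarDot e (s • x + t • y) = s * planarDot e x + t * planarDot e y := by
  simp [planarDot]; ring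

/-- An open half-plane together with one of its two open boundary rays is a convex cone that omits
`0`. Including only one ray is what makes collinear points and degenerate polygons come out right.
-/
theorem LeftOf.combo {e x y : Plane} (hx : LeftOf e x) (hy : LeftOf e y) {s t : ℝ}
    (hs : 0 ≤ s) (ht : 0 ≤ t) (hst : s + t = 1) : LeftOf e (s • x + t • y) := by
  unfold LeftOf at *
  rw [planarCross_combo, planarDot_combo]
  rcases hs.eq_or_lt with rfl | hs
  · obtain rfl : t = 1 := by linarith
    simpa using hy
  rcases ht.eq_or_lt with rfl | ht
  · obtain rfl : s = 1 := by linarith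
    simpa using hx
  rcases hx with hx | ⟨hx, hx'⟩ <;> rcases hy with hy | ⟨hy, hy'⟩
  · left; positivity
  · left; rw [hy]; simpa using mul_pos hs hx
  · left; rw [hx]; simpa using mul_pos ht hy
  · right
    rw [hx, hy]
    exact ⟨by simp, by nlinarith⟩

theorem LeftOf.smul {e x : Plane} (hx : LeftOf e x) {s : ℝ} (hs : 0 < s) : LeftOf e (s • x) := by
  unfold LeftOf at *
  have h1 : planarCross e (s • x) = s * planarCross e x := by simp [planarCross]; ring
  have h2 : planarDot e (s • x) = s * planarDot e x := by simp [planarDot]; ring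
  rw [h1, h2]
  rcases hx with hx | ⟨hx, hx'⟩
  · left; positivity
  · right; exact ⟨by simp [hx], by nlinarith⟩

/-- The points that equal `v` or are to the left of `e`, seen from `v`, form a convex set. -/
theorem convex_leftOf (v e : Plane) : Convex ℝ {q : Plane | q ≠ v → LeftOf e (q - v)} := by
  intro x hx y hy s t hs ht hst hne
  have key : s • x + t • y - v = s • (x - v) + t • (y - v) := by
    have : v = (s + t) • v := by rw [hst, one_smul]
    nth_rewrite 1 [this]
    rw [add_smul, smul_sub, smul_sub]; abel
  rw [key]
  by_cases hxv : x = v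
  · by_cases hyv : y = v
    · subst hxv hyv
      rw [← add_smul, hst, one_smul] at hne
      exact absurd rfl hne
    · subst hxv
      have ht0 : t ≠ 0 := by
        rintro rfl
        apply hne
        rw [← sub_eq_zero, key]; simp
      simpa using (hy hyv).smul (lt_of_le_of_ne ht ht0.symm)
  · by_cases hyv : y = v
    · subst hyv
      have hs0 : s ≠ 0 := by
        rintro rfl
        apply hne
        rw [← sub_eq_zero, key]; simp
      simpa using (hx hxv).smul (lt_of_le_of_ne hs hs0.symm)
    · exact (hx hxv).combo (hy hyv) hs ht hst

/-- The directed line from `v` to `v'` supports `L`, with `v'` the last point of `L` on it. -/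
def SupportingStep (L : Set Plane) (v v' : Plane) : Prop :=
  ∀ q ∈ L, q ≠ v' → LeftOf (v' - v) (q - v')

theorem SupportingStep.convexHull {L : Set Plane} {v v' : Plane} (h : SupportingStep L v v') :
    SupportingStep (convexHull ℝ L) v v' := fun _ hq =>
  convexHull_min (s := L) (fun _ hq => h _ hq) (convex_leftOf v' (v' - v)) hq

theorem SupportingStep.cross_nonneg {L : Set Plane} {v v' : Plane} (h : SupportingStep L v v')
    {q : Plane} (hq : q ∈ L) : 0 ≤ planarCross (v' - v) (q - v) := by
  have key : planarCross (v' - v) (q - v) = planarCross (v' - v) (q - v') := by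
    simp [planarCross]; ring
  rw [key]
  by_cases hne : q = v'
  · simp [hne, planarCross]
  · exact (h q hq hne).cross_nonneg

/-- The displacements from `v'` to the other points of the hull lie in a convex cone omitting `0`,
so they cannot average to `0`. -/
theorem SupportingStep.mem_extremePoints {L : Set Plane} {v v' : Plane}
    (h : SupportingStep L v v') (hv' : v' ∈ L) : v' ∈ (_root_.convexHull ℝ L).extremePoints ℝ := by
  refine ⟨subset_convexHull ℝ L hv', ?_⟩
  rintro x hx y hy ⟨s, t, hs, ht, hst, hxy⟩
  by_contra hne
  have hyne : y ≠ v' := by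
    rintro rfl
    apply hne
    have hs1 : s • (x - y) = 0 := by
      have : y = (s + t) • y := by rw [hst, one_smul]
      rw [smul_sub, sub_eq_zero]
      have h3 : s • x + t • y = s • y + t • y := by rw [hxy, ← add_smul, hst, one_smul]
      exact add_right_cancel h3
    rcases smul_eq_zero.1 hs1 with h0 | h0
    · exact absurd h0 hs.ne'
    · exact sub_eq_zero.1 h0
  have h1 := (h.convexHull x hx hne).combo (h.convexHull y hy hyne) hs.le ht.le hst
  have h2 : s • (x - v') + t • (y - v') = 0 := by
    have : s • (x - v') + t • (y - v') = (s • x + t • y) - (s + t) • v' := by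
      rw [add_smul, smul_sub, smul_sub]; abel
    rw [this, hxy, hst, one_smul, sub_self]
  rw [h2] at h1
  exact not_leftOf_zero_right _ h1

/-- The last two hypotheses make `u` and `z` parallel, with `u · z` less than both `|u|²` and
`|z|²`. Since `(u · z)² = |u|² |z|²`, the product `u · z` is negative and `z` is a negative multiple
of `u`. But the angles in `(0, π]` contain no two opposite directions. -/
theorem leftOf_antisymm {e u z : Plane} (hu : LeftOf e u) (hz : LeftOf e z)
    (h1 : LeftOf u (z - u)) (h2 : LeftOf z (u - z)) : False := by
  simp only [LeftOf, planarCross, planarDot, PiLp.sub_apply] at *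
  generalize e 0 = e0 at *
  generalize e 1 = e1 at *
  generalize u 0 = u0 at *
  generalize u 1 = u1 at *
  generalize z 0 = z0 at *
  generalize z 1 = z1 at *
  have hc : u0 * z1 - u1 * z0 = 0 := by
    rcases h1 with h1 | h1 <;> rcases h2 with h2 | h2 <;> linarith [h1, h2]
  have d1 : u0 * (z0 - u0) + u1 * (z1 - u1) < 0 := by
    rcases h1 with h1 | h1
    · linarith
    · exact h1.2
  have d2 : z0 * (u0 - z0) + z1 * (u1 - z1) < 0 := by
    rcases h2 with h2 | h2
    · linarith
    · exact h2.2
  set D := u0 * z0 + u1 * z1 with hD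
  set U := u0 * u0 + u1 * u1 with hU
  have hU0 : 0 ≤ U := by nlinarith
  have hlag : D * D = U * (z0 * z0 + z1 * z1) := by
    have : D * D = U * (z0 * z0 + z1 * z1) - (u0 * z1 - u1 * z0) ^ 2 := by rw [hD, hU]; ring
    rw [this, hc]; ring
  have hDneg : D < 0 := by
    by_contra hD0
    push Not at hD0
    have q1 : D < U := by linarith
    have q2 : D < z0 * z0 + z1 * z1 := by linarith
    nlinarith
  have hUpos : 0 < U := by
    rcases hU0.eq_or_lt with h | h
    · rw [← h] at hlag; nlinarith
    · exact h
  have ez0 : U * z0 = D * u0 := by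
    have : U * z0 - D * u0 = -u1 * (u0 * z1 - u1 * z0) := by rw [hD, hU]; ring
    rw [hc] at this; linarith
  have ez1 : U * z1 = D * u1 := by
    have : U * z1 - D * u1 = u0 * (u0 * z1 - u1 * z0) := by rw [hD, hU]; ring
    rw [hc] at this; linarith
  have ec : U * (e0 * z1 - e1 * z0) = D * (e0 * u1 - e1 * u0) := by
    linear_combination e0 * ez1 - e1 * ez0
  have ed : U * (e0 * z0 + e1 * z1) = D * (e0 * u0 + e1 * u1) := by
    linear_combination e0 * ez0 + e1 * ez1
  rcases hu with hu | ⟨hu, hu'⟩ <;> rcases hz with hz | ⟨hz, hz'⟩ <;> nlinarith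

/-- The incoming step confines both candidates to one half-plane as seen from `v`; without it,
`leftOf_antisymm` would not apply. -/
theorem SupportingStep.unique {L : Set Plane} {w v v' v'' : Plane} (h : SupportingStep L w v)
    (h' : SupportingStep L v v') (h'' : SupportingStep L v v'') (m' : v' ∈ L) (m'' : v'' ∈ L) :
    v' = v'' := by
  by_contra hne
  have a1 := h' v'' m'' (Ne.symm hne)
  have a2 := h'' v' m' hne
  have n1 : v' ≠ v := by
    rintro rfl
    rw [sub_self] at a1; exact not_leftOf_zero_left _ a1
  have n2 : v'' ≠ v := by
    rintro rfl
    rw [sub_self] at a2; exact not_leftOf_zero_left _ a2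
  refine leftOf_antisymm (h v' m' n1) (h v'' m'' n2) ?_ ?_
  · rwa [sub_sub_sub_cancel_right]
  · rwa [sub_sub_sub_cancel_right]

/-- At a point where two supporting steps meet, a linear functional that does not grow along the
steps away from it does not grow towards any point of the set. -/
theorem SupportingStep.le_of_local_max {L : Set Plane} {p v n q : Plane}
    (h₁ : SupportingStep L p v) (h₂ : SupportingStep L v n) (hn : n ∈ L) (hq : q ∈ L)
    (f : Plane →L[ℝ] ℝ) (hp : f p ≤ f v) (hfn : f n ≤ f v) : f q ≤ f v := by
  by_contra hlt
  push Not at hlt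
  have qv : q ≠ v := by rintro rfl; exact lt_irrefl _ hlt
  have qn : q ≠ n := by rintro rfl; exact absurd hlt (not_lt.2 hfn)
  have a1 := h₁ q hq qv
  have a2 := h₂ q hq qn
  have nv : n ≠ v := by
    rintro rfl
    rw [sub_self] at a2; exact not_leftOf_zero_left _ a2
  have a3 := h₁ n hn nv
  have hw : 0 < f (q - v) := by rw [map_sub]; linarith
  have hu : f (n - v) ≤ 0 := by rw [map_sub]; linarith
  have he : 0 ≤ f (v - p) := by rw [map_sub]; linarith
  have c2 := h₂.cross_nonneg hq
  generalize q - v = w at *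
  generalize n - v = u at *
  generalize v - p = e at *
  have c1 := a1.cross_nonneg
  rcases a3 with a3 | ⟨a3, a3'⟩
  · have id1 : planarCross e u • w = planarCross e w • u - planarCross u w • e := by
      ext i; fin_cases i <;> simp [planarCross] <;> ring
    have id2 := congrArg f id1
    simp only [map_sub, map_smul, smul_eq_mul] at id2
    nlinarith [mul_nonneg c2 he, mul_nonneg c1 (neg_nonneg.2 hu), mul_pos a3 hw]
  · have id0 : planarDot e u * planarCross e w = planarDot e e * planarCross u w
        + planarCross e u * planarDot e w := by
      simp [planarDot, planarCross]; ring
    have hee : 0 ≤ planarDot e e := by simp only [planarDot]; nlinarith [sq_nonneg (e 0), sq_nonneg (e 1)]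
    rw [a3] at id0
    have hcw : planarCross e w = 0 := by
      by_contra hne
      have := lt_of_le_of_ne c1 (Ne.symm hne)
      nlinarith [mul_nonneg hee c2]
    rcases a1 with a1 | ⟨_, a1⟩
    · linarith
    have id1 : planarDot e e • w = planarDot e w • e + planarCross e w • (!₂[- e 1, e 0] : Plane) := by
      ext i; fin_cases i <;> simp [planarCross, planarDot] <;> ring
    rw [hcw, zero_smul, add_zero] at id1
    have id2 := congrArg f id1
    simp only [map_smul, smul_eq_mul] at id2
    have hee' : 0 < planarDot e e := by
      rcases hee.eq_or_lt with h0 | h0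
      · exfalso
        simp only [planarDot] at h0 a1
        have e0 : e 0 = 0 := by nlinarith [sq_nonneg (e 0), sq_nonneg (e 1)]
        have e1 : e 1 = 0 := by nlinarith [sq_nonneg (e 0), sq_nonneg (e 1)]
        simp [e0, e1] at a1
      · exact h0
    nlinarith [mul_pos hee' hw]

/-- A closed walk along supporting steps that returns to its start only at the end lists the
vertices of the convex hull. -/
theorem isCCWVertexList_of_closed_walk {L : Set Plane} {v₀ : Plane} {V : List Plane}
    (hV : ∀ v ∈ V, v ∈ L) (hchain : List.IsChain (SupportingStep L) (v₀ :: V))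
    (hlast : V.getLast? = some v₀) (hint : v₀ ∉ V.dropLast) :
    IsCCWVertexList (convexHull ℝ L) V := by
  have hne : V ≠ [] := by rintro rfl; simp at hlast
  have hn : 0 < V.length := List.length_pos_iff.2 hne
  have hl : V[V.length - 1] = v₀ := by
    rw [List.getLast?_eq_getElem?] at hlast
    rw [List.getElem?_eq_some_iff] at hlast
    exact hlast.2
  have hch := List.isChain_iff_getElem.1 hchain
  have hpred : ∀ i (hi : i < V.length), ∃ p ∈ V, SupportingStep L p V[i] := by
    intro i hi
    have h1 := hch i (by simpa using hi)
    refine ⟨_, ?_, h1⟩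
    rcases i with _ | i
    · simp only [List.getElem_cons_zero]
      rw [← hl]; exact List.getElem_mem _
    · simp only [List.getElem_cons_succ]; exact List.getElem_mem _
  have hnext : ∀ i (hi : i < V.length),
      SupportingStep L V[i] (V[(i + 1) % V.length]'(Nat.mod_lt _ hn)) := by
    intro i hi
    by_cases h : i + 1 < V.length
    · have h1 := hch (i + 1) (by simpa using h)
      simp only [List.getElem_cons_succ] at h1
      simpa only [Nat.mod_eq_of_lt h] using h1
    · obtain rfl : i = V.length - 1 := by omega
      have h1 := hch 0 (by simpa using hn)
      simp only [List.getElem_cons_succ, List.getElem_cons_zero] at h1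
      have e : (V.length - 1 + 1) % V.length = 0 := by
        rw [Nat.sub_add_cancel hn, Nat.mod_self]
      simp only [e, hl]
      exact h1
  -- A functional separating `q` from the walk attains its maximum over the walk at some `V[i]`;
  -- this local maximum is global, so it bounds `f q` as well.
  have hsub : L ⊆ convexHull ℝ {p | p ∈ V} := by
    intro q hq
    by_contra hqc
    have hfin : ({p | p ∈ V} : Set Plane).Finite := List.finite_toSet V
    obtain ⟨f, u, hf, hu⟩ := geometric_hahn_banach_closed_point (convex_convexHull ℝ _)
      (hfin.isClosed_convexHull ℝ) hqc
    obtain ⟨v, hv, hmax⟩ := hfin.exists_maximalFor f _ ⟨V[0], List.getElem_mem _⟩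
    have hmax' : ∀ w ∈ V, f w ≤ f v := by
      intro w hw
      rcases le_total (f w) (f v) with h | h
      · exact h
      · exact hmax hw h
    obtain ⟨i, hi, rfl⟩ := List.getElem_of_mem hv
    obtain ⟨p, hp, hpv⟩ := hpred i hi
    have hn' := List.getElem_mem (Nat.mod_lt (i + 1) hn)
    have h1 := hpv.le_of_local_max (hnext i hi) (hV _ hn') hq f (hmax' p hp) (hmax' _ hn')
    have h2 := hf _ (subset_convexHull ℝ _ hv)
    linarith
  have hhull : convexHull ℝ L = convexHull ℝ {p | p ∈ V} :=
    Set.Subset.antisymm (convexHull_min hsub (convex_convexHull ℝ _))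
      (convexHull_mono fun p hp => hV p hp)
  refine ⟨?_, ?_, ?_⟩
  · rw [List.nodup_iff_injective_getElem]
    -- A repetition propagates forwards, since successors are unique, until its later copy is the
    -- last entry `v₀`; the earlier copy is then a premature return.
    have key : ∀ d i j (hi : i < V.length) (hj : j < V.length), V[i] = V[j] → i < j →
        j + d = V.length - 1 → False := by
      intro d
      induction d with
      | zero =>
        intro i j hi hj hij hlt hjd
        obtain rfl : j = V.length - 1 := by omega
        rw [hl] at hij
        apply hint
        rw [← hij, List.mem_iff_getElem]
        refine ⟨i, by simpa using hlt, by simp⟩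
      | succ d ih =>
        intro i j hi hj hij hlt hjd
        refine ih (i + 1) (j + 1) (by omega) (by omega) ?_ (by omega) (by omega)
        obtain ⟨p, hp, hpv⟩ := hpred i hi
        have h1 := hnext i hi
        have h2 := hnext j hj
        simp only [Nat.mod_eq_of_lt (show i + 1 < V.length by omega)] at h1
        simp only [Nat.mod_eq_of_lt (show j + 1 < V.length by omega)] at h2
        rw [← hij] at h2
        exact hpv.unique h1 h2 (hV _ (List.getElem_mem _)) (hV _ (List.getElem_mem _))
    rintro ⟨i, hi⟩ ⟨j, hj⟩ hij
    simp only at hij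
    rcases lt_trichotomy i j with h | h | h
    · exact (key (V.length - 1 - j) i j hi hj hij h (by omega)).elim
    · simpa using h
    · exact (key (V.length - 1 - i) j i hj hi hij.symm h (by omega)).elim
  · apply Set.Subset.antisymm
    · intro v hv
      obtain ⟨i, hi, rfl⟩ := List.getElem_of_mem hv
      obtain ⟨p, hp, hpv⟩ := hpred i hi
      exact hpv.mem_extremePoints (hV _ hv)
    · rw [hhull]
      exact extremePoints_convexHull_subset
  · intro i q hq
    exact (hnext i.1 i.2).convexHull.cross_nonneg hq

/-! ### Lattice geometry of the disk and the search for the next edge direction. -/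

/-- The cross product of integer vectors. -/
def icross (u w : ℤ × ℤ) : ℤ := u.1 * w.2 - u.2 * w.1

/-- The dot product of integer vectors. -/
def idot (u w : ℤ × ℤ) : ℤ := u.1 * w.1 + u.2 * w.2

/-- The angle from `e` to `w` lies in `(0, π]`. -/
def ILeftOf (e w : ℤ × ℤ) : Prop :=
  0 < icross e w ∨ icross e w = 0 ∧ idot e w < 0

/-- The point with coordinates `x, y` lies in the disk with center `c` and radius `r`. -/
def OnDisk (c : Plane) (r x y : ℝ) : Prop :=
  (x - c 0) ^ 2 + (y - c 1) ^ 2 ≤ r ^ 2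

/-- The integer point `q` lies in the disk with center `c` and radius `r`. -/
def InDisk (c : Plane) (r : ℝ) (q : ℤ × ℤ) : Prop :=
  OnDisk c r q.1 q.2

/-- Rotation by a right angle. -/
def irot (u : ℤ × ℤ) : ℤ × ℤ := (-u.2, u.1)

/-- `w` lies in the half-open quadrant from `a₀` (excluded) counterclockwise to `irot a₀`. -/
def InQuadrant (a₀ w : ℤ × ℤ) : Prop := 0 ≤ idot a₀ w ∧ 0 < icross a₀ w

/-- All lattice points of the disk other than `v` are to the left of `e`, seen from `v`. -/
def Supports (c : Plane) (r : ℝ) (e v : ℤ × ℤ) : Prop :=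
  ∀ q, InDisk c r q → q ≠ v → ILeftOf e (q - v)

/-- The state of the search for the clockwise-most lattice direction in the quadrant of `a₀`. -/
structure SearchInv (c : Plane) (r : ℝ) (v a₀ a b : ℤ × ℤ) : Prop where
  mem : InDisk c r v
  det : icross a b = 1
  dot : 0 ≤ idot a b
  a_out : ¬ InDisk c r (v + a)
  b_in : InDisk c r (v + b)
  a_dot : 0 ≤ idot a₀ a
  a_cross : 0 ≤ icross a₀ a
  b_quad : InQuadrant a₀ b
  sep : ∀ w, InDisk c r (v + w) → InQuadrant a₀ w → 0 < icross a w

theorem icross_add_smul (u a b : ℤ × ℤ) (k : ℤ) :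
    icross u (a + k • b) = icross u a + k * icross u b := by
  simp [icross]; ring

theorem idot_add_smul (u a b : ℤ × ℤ) (k : ℤ) :
    idot u (a + k • b) = idot u a + k * idot u b := by
  simp [idot]; ring

theorem add_smul_icross (u a b : ℤ × ℤ) (k : ℤ) :
    icross (a + k • b) u = icross a u + k * icross b u := by
  simp [icross]; ring

theorem add_smul_idot (u a b : ℤ × ℤ) (k : ℤ) :
    idot (a + k • b) u = idot a u + k * idot b u := by
  simp [idot]; ring

theorem icross_self (a : ℤ × ℤ) : icross a a = 0 := by simp [icross]; ring

theorem idot_comm (a b : ℤ × ℤ) : idot a b = idot b a := by simp [idot]; ring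

theorem icross_swap (a b : ℤ × ℤ) : icross a b = - icross b a := by simp [icross]; ring

theorem idot_self_nonneg (a : ℤ × ℤ) : 0 ≤ idot a a := by
  simp only [idot]; nlinarith [sq_nonneg a.1, sq_nonneg a.2]

/-- Coordinates with respect to a basis of the lattice. -/
theorem eq_basis_combo {a b : ℤ × ℤ} (h : icross a b = 1) (w : ℤ × ℤ) :
    w = (-icross b w) • a + (icross a w) • b := by
  simp only [icross] at *
  ext
  · simp; linear_combination (-w.1) * h
  · simp; linear_combination (-w.2) * h

/-- Jensen's inequality for three points of a disk, with integer weights. -/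
theorem onDisk_combo {c : Plane} {r : ℝ} {x₁ y₁ x₂ y₂ x₃ y₃ x y l₁ l₂ l₃ s : ℝ}
    (h₁ : OnDisk c r x₁ y₁) (h₂ : OnDisk c r x₂ y₂) (h₃ : OnDisk c r x₃ y₃)
    (p₁ : 0 ≤ l₁) (p₂ : 0 ≤ l₂) (p₃ : 0 ≤ l₃) (hs : l₁ + l₂ + l₃ = s) (s0 : 0 < s)
    (hx : s * x = l₁ * x₁ + l₂ * x₂ + l₃ * x₃) (hy : s * y = l₁ * y₁ + l₂ * y₂ + l₃ * y₃) :
    OnDisk c r x y := by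
  simp only [OnDisk] at *
  generalize c 0 = p at *
  generalize c 1 = q at *
  have key : s * (s * ((x - p) ^ 2 + (y - q) ^ 2)) ≤ s * (s * r ^ 2) := by
    have e1 : s * (s * ((x - p) ^ 2 + (y - q) ^ 2)) = (s * x - s * p) ^ 2 + (s * y - s * q) ^ 2 := by
      ring
    rw [e1, hx, hy, ← hs]
    -- The variance identity: the defect in Jensen's inequality is a weighted sum of squared
    -- pairwise distances.
    have e2 : (l₁ + l₂ + l₃) * (l₁ * ((x₁ - p) ^ 2 + (y₁ - q) ^ 2)
        + l₂ * ((x₂ - p) ^ 2 + (y₂ - q) ^ 2) + l₃ * ((x₃ - p) ^ 2 + (y₃ - q) ^ 2))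
        - ((l₁ * x₁ + l₂ * x₂ + l₃ * x₃ - (l₁ + l₂ + l₃) * p) ^ 2
          + (l₁ * y₁ + l₂ * y₂ + l₃ * y₃ - (l₁ + l₂ + l₃) * q) ^ 2)
        = l₁ * l₂ * ((x₁ - x₂) ^ 2 + (y₁ - y₂) ^ 2) + l₁ * l₃ * ((x₁ - x₃) ^ 2 + (y₁ - y₃) ^ 2)
          + l₂ * l₃ * ((x₂ - x₃) ^ 2 + (y₂ - y₃) ^ 2) := by ring
    have e3 : 0 ≤ l₁ * l₂ * ((x₁ - x₂) ^ 2 + (y₁ - y₂) ^ 2)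
          + l₁ * l₃ * ((x₁ - x₃) ^ 2 + (y₁ - y₃) ^ 2)
          + l₂ * l₃ * ((x₂ - x₃) ^ 2 + (y₂ - y₃) ^ 2) := by positivity
    have e4 : l₁ * ((x₁ - p) ^ 2 + (y₁ - q) ^ 2)
        + l₂ * ((x₂ - p) ^ 2 + (y₂ - q) ^ 2) + l₃ * ((x₃ - p) ^ 2 + (y₃ - q) ^ 2)
        ≤ (l₁ + l₂ + l₃) * r ^ 2 := by
      nlinarith [mul_le_mul_of_nonneg_left h₁ p₁, mul_le_mul_of_nonneg_left h₂ p₂,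
        mul_le_mul_of_nonneg_left h₃ p₃]
    have e5 := mul_le_mul_of_nonneg_left e4 (hs ▸ s0.le)
    linarith
  exact le_of_mul_le_mul_left (le_of_mul_le_mul_left key s0) s0

/-- If a lattice point `i a + j b` lies in the disk, then so does `a + n b`, for `n` the least
integer that is at least `j / i`. -/
theorem inDisk_of_inDisk_combo {c : Plane} {r : ℝ} {v a b : ℤ × ℤ} {i j n : ℤ}
    (hv : InDisk c r v) (hb : InDisk c r (v + b)) (hi : 0 < i)
    (hw : InDisk c r (v + (i • a + j • b))) (h1 : j ≤ i * n) (h2 : i * n < j + i) :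
    InDisk c r (v + (a + n • b)) := by
  have h1' : (j : ℝ) ≤ i * n := by exact_mod_cast h1
  have h2' : (i : ℝ) * n + 1 ≤ j + i := by exact_mod_cast h2
  have hi' : (0 : ℝ) < i := by exact_mod_cast hi
  -- Since `i (a + n b) = (i a + j b) + (i n - j) b`, the point is the average of `v`, `v + b` and
  -- `v + (i a + j b)` with these weights.
  refine onDisk_combo hv hb hw (l₁ := i - 1 - (i * n - j)) (l₂ := i * n - j) (l₃ := 1) (s := i)
    (by linarith) (by linarith) zero_le_one (by ring) hi' ?_ ?_
  · simp; ring
  · simp; ring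

theorem inDisk_of_between {c : Plane} {r : ℝ} {v b : ℤ × ℤ} {j k : ℤ} (hv : InDisk c r v)
    (hj : InDisk c r (v + j • b)) (h0 : 0 ≤ k) (hk : k ≤ j) : InDisk c r (v + k • b) := by
  rcases h0.eq_or_lt with rfl | h0
  · simpa using hv
  have h0' : (0 : ℝ) < k := by exact_mod_cast h0
  have hk' : (k : ℝ) ≤ j := by exact_mod_cast hk
  refine onDisk_combo hv hv hj (l₁ := j - k) (l₂ := 0) (l₃ := k) (s := j)
    (by linarith) le_rfl h0'.le (by ring) (by linarith) ?_ ?_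
  · simp; ring
  · simp; ring

theorem unit_cases {a₀ : ℤ × ℤ} (h : idot a₀ a₀ = 1) (w : ℤ × ℤ) :
    w = idot a₀ w • a₀ + icross a₀ w • irot a₀ := by
  simp only [idot, icross, irot] at *
  ext
  · simp; linear_combination (-w.1) * h
  · simp; linear_combination (-w.2) * h

theorem icross_eq_of_unit {a₀ : ℤ × ℤ} (h : idot a₀ a₀ = 1) (u w : ℤ × ℤ) :
    icross u w = idot a₀ u * icross a₀ w - icross a₀ u * idot a₀ w := by
  simp only [idot, icross] at *
  linear_combination (-(u.1 * w.2 - u.2 * w.1)) * h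

theorem idot_eq_of_unit {a₀ : ℤ × ℤ} (h : idot a₀ a₀ = 1) (u w : ℤ × ℤ) :
    idot u w = idot a₀ u * idot a₀ w + icross a₀ u * icross a₀ w := by
  simp only [idot, icross] at *
  linear_combination (-(u.1 * w.1 + u.2 * w.2)) * h

theorem irot_unit {a₀ : ℤ × ℤ} (h : idot a₀ a₀ = 1) : idot (irot a₀) (irot a₀) = 1 := by
  simp only [idot, irot] at *; linarith

theorem idot_irot (a₀ w : ℤ × ℤ) : idot (irot a₀) w = icross a₀ w := by
  simp only [idot, irot, icross]; ring

theorem icross_irot (a₀ w : ℤ × ℤ) : icross (irot a₀) w = - idot a₀ w := by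
  simp only [idot, irot, icross]; ring

theorem idot_self_irot (a₀ : ℤ × ℤ) : idot a₀ (irot a₀) = 0 := by
  simp only [idot, irot]; ring

theorem icross_self_irot (a₀ : ℤ × ℤ) : icross a₀ (irot a₀) = idot a₀ a₀ := by
  simp only [idot, irot, icross]; ring

/-- In a closed quadrant, the first direction is not to the left of any other. -/
theorem not_inDisk_add_unit {c : Plane} {r : ℝ} {v e a₀ : ℤ × ℤ} (h0 : idot a₀ a₀ = 1)
    (he : Supports c r e v) (e1 : 0 ≤ idot a₀ e) (e2 : 0 ≤ icross a₀ e) :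
    ¬ InDisk c r (v + a₀) := by
  intro h
  have hne : v + a₀ ≠ v := by
    intro h'
    have : a₀ = 0 := by simpa using h'
    rw [this] at h0; simp [idot] at h0
  have h1 := he _ h hne
  rw [add_sub_cancel_left] at h1
  rcases h1 with h1 | ⟨h1, h2⟩
  · rw [icross_swap] at h1; linarith
  · rw [idot_comm] at h2; linarith

theorem searchInv_start {c : Plane} {r : ℝ} {v e a₀ : ℤ × ℤ} (h0 : idot a₀ a₀ = 1)
    (hv : InDisk c r v) (he : Supports c r e v) (e1 : 0 ≤ idot a₀ e) (e2 : 0 ≤ icross a₀ e)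
    (hb : InDisk c r (v + irot a₀)) : SearchInv c r v a₀ a₀ (irot a₀) where
  mem := hv
  det := by rw [icross_self_irot, h0]
  dot := (idot_self_irot a₀).ge
  a_out := not_inDisk_add_unit h0 he e1 e2
  b_in := hb
  a_dot := by rw [h0]; exact zero_le_one
  a_cross := (icross_self a₀).ge
  b_quad := ⟨(idot_self_irot a₀).ge, by rw [icross_self_irot, h0]; exact zero_lt_one⟩
  sep := fun _ _ h => h.2

/-- A shear along `a` keeps the determinant, and `sep` does not involve `b`. With `k` maximal, `v +
a + b` leaves the disk for the new `b`, so the next step has `m ≥ 2`. -/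
theorem SearchInv.grow {c : Plane} {r : ℝ} {v a₀ a b : ℤ × ℤ} (h : SearchInv c r v a₀ a b)
    {k : ℤ} (hk : 0 ≤ k) (hin : InDisk c r (v + (b + k • a))) :
    SearchInv c r v a₀ a (b + k • a) where
  mem := h.mem
  det := by rw [icross_add_smul, icross_self, h.det]; ring
  dot := by rw [idot_add_smul]; nlinarith [h.dot, idot_self_nonneg a]
  a_out := h.a_out
  b_in := hin
  a_dot := h.a_dot
  a_cross := h.a_cross
  b_quad := ⟨by rw [idot_add_smul]; nlinarith [h.a_dot, h.b_quad.1],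
    by rw [icross_add_smul]; nlinarith [h.a_cross, h.b_quad.2]⟩
  sep := h.sep

theorem SearchInv.idot_grow {c : Plane} {r : ℝ} {v a₀ a b : ℤ × ℤ} (h : SearchInv c r v a₀ a b)
    {k : ℤ} (hk : 0 ≤ k) : idot b b ≤ idot (b + k • a) (b + k • a) := by
  rw [idot_add_smul, add_smul_idot, add_smul_idot, idot_comm b a]
  nlinarith [mul_nonneg hk h.dot, mul_nonneg (mul_nonneg hk hk) (idot_self_nonneg a)]

/-- To the right of `b` and to the left of `a`, the direction `w = i a + j b` has positive
coordinates. Convexity brings it down to the line `i = 1`, at `n = ⌈j / i⌉`; so one line query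
decides whether such a `w` exists. -/
theorem SearchInv.exists_of_right {c : Plane} {r : ℝ} {v a₀ a b w : ℤ × ℤ}
    (h : SearchInv c r v a₀ a b) (hw : InDisk c r (v + w)) (hq : InQuadrant a₀ w)
    (hright : icross b w < 0) :
    ∃ n : ℤ, 1 ≤ n ∧ InDisk c r (v + (a + n • b)) ∧
      icross a w ≤ -icross b w * n ∧ -icross b w * n < icross a w + -icross b w := by
  have hj := h.sep w hw hq
  set i := -icross b w with hi
  set j := icross a w with hj'
  have hi0 : 0 < i := by omega
  have d1 := Int.mul_ediv_add_emod (j + i - 1) i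
  have d2 := Int.emod_nonneg (j + i - 1) hi0.ne'
  have d3 := Int.emod_lt_of_pos (j + i - 1) hi0
  set n := (j + i - 1) / i
  have h1 : j ≤ i * n := by omega
  have h2 : i * n < j + i := by omega
  refine ⟨n, ?_, ?_, h1, h2⟩
  · by_contra hn
    nlinarith
  · rw [eq_basis_combo h.det w] at hw
    exact inDisk_of_inDisk_combo h.mem h.b_in hi0 hw h1 h2

/-- For `sep`, a direction that is not to the right of `b` is to the left of every `a + n b` with `n
≥ 0`. For `w = i a + j b` to the right of `b`, `⌈j / i⌉ ≥ m` by minimality of `m`, so `j > i (m -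
1)`. -/
theorem SearchInv.step {c : Plane} {r : ℝ} {v a₀ a b : ℤ × ℤ} (h : SearchInv c r v a₀ a b)
    {m : ℤ} (hm : 1 ≤ m) (hin : InDisk c r (v + (a + m • b)))
    (hmin : ∀ n, 1 ≤ n → n < m → ¬ InDisk c r (v + (a + n • b))) :
    SearchInv c r v a₀ (a + (m - 1) • b) (a + (m - 1) • b + b) := by
  have eb : a + (m - 1) • b + b = a + m • b := by
    rw [sub_smul, one_smul]; abel
  rw [eb]
  refine ⟨h.mem, ?_, ?_, ?_, hin, ?_, ?_, ⟨?_, ?_⟩, ?_⟩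
  · rw [icross_add_smul, add_smul_icross, add_smul_icross, icross_self, icross_self, h.det,
      icross_swap b a, h.det]; ring
  · rw [idot_add_smul, add_smul_idot, add_smul_idot, idot_comm b a]
    nlinarith [h.dot, idot_self_nonneg a, idot_self_nonneg b, mul_nonneg (sub_nonneg.2 hm) h.dot,
      mul_nonneg (mul_nonneg (sub_nonneg.2 hm) (by linarith : (0 : ℤ) ≤ m)) (idot_self_nonneg b)]
  · rcases hm.eq_or_lt with rfl | hm'
    · simpa using h.a_out
    · exact hmin _ (by omega) (by omega)
  · rw [idot_add_smul]; nlinarith [h.a_dot, h.b_quad.1]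
  · rw [icross_add_smul]; nlinarith [h.a_cross, h.b_quad.2]
  · rw [idot_add_smul]; nlinarith [h.a_dot, h.b_quad.1]
  · rw [icross_add_smul]; nlinarith [h.a_cross, h.b_quad.2]
  · intro w hw hq
    have hj := h.sep w hw hq
    rw [add_smul_icross]
    by_cases hright : icross b w < 0
    · obtain ⟨n, hn, hnin, h1, h2⟩ := h.exists_of_right hw hq hright
      have hmn : m ≤ n := by
        by_contra hlt
        exact hmin n hn (by omega) hnin
      nlinarith
    · nlinarith

/-- As `a · b ≥ 0`, `|a + m b|² ≥ m² |b|²`. This is the source of the logarithm. -/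
theorem SearchInv.idot_step {c : Plane} {r : ℝ} {v a₀ a b : ℤ × ℤ} (h : SearchInv c r v a₀ a b)
    {m : ℤ} (hm : 2 ≤ m) :
    4 * idot b b ≤ idot (a + (m - 1) • b + b) (a + (m - 1) • b + b) := by
  have eb : a + (m - 1) • b + b = a + m • b := by
    rw [sub_smul, one_smul]; abel
  rw [eb, idot_add_smul, add_smul_idot, add_smul_idot, idot_comm b a]
  nlinarith [h.dot, idot_self_nonneg a, idot_self_nonneg b, mul_nonneg (sub_nonneg.2 hm) h.dot,
      mul_nonneg (mul_nonneg (sub_nonneg.2 hm) (by linarith : (0 : ℤ) ≤ m + 2))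
        (idot_self_nonneg b)]

theorem SearchInv.cross_nonneg_of_done {c : Plane} {r : ℝ} {v a₀ a b w : ℤ × ℤ}
    (h : SearchInv c r v a₀ a b) (hdone : ∀ n : ℤ, 1 ≤ n → ¬ InDisk c r (v + (a + n • b)))
    (hw : InDisk c r (v + w)) (hq : InQuadrant a₀ w) : 0 ≤ icross b w := by
  by_contra hlt
  obtain ⟨n, hn, hin, -⟩ := h.exists_of_right hw hq (not_le.1 hlt)
  exact hdone n hn hin

/-- A disk direction to the right of `b` is still to the left of the incoming direction `e`. Both
`e` and `b` belong to the closed quadrant, so it would lie in the quadrant, where the finished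
search excludes it. On the line of `b` itself, maximality of `k` and convexity exclude points beyond
`v + k b`. -/
theorem SearchInv.supports {c : Plane} {r : ℝ} {v e a₀ a b : ℤ × ℤ} (h0 : idot a₀ a₀ = 1)
    (h : SearchInv c r v a₀ a b) (hdone : ∀ n : ℤ, 1 ≤ n → ¬ InDisk c r (v + (a + n • b)))
    (he : Supports c r e v) (e1 : 0 ≤ idot a₀ e) (e2 : 0 ≤ icross a₀ e)
    {k : ℤ} (hk : 1 ≤ k) (hmax : ¬ InDisk c r (v + (k + 1) • b)) :
    Supports c r (k • b) (v + k • b) := by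
  intro q hq hne
  obtain ⟨w, rfl⟩ : ∃ w, q = v + w := ⟨q - v, by abel⟩
  have hwb : v + w - (v + k • b) = w - k • b := by abel
  rw [hwb]
  have hc1 : icross (k • b) (w - k • b) = k * icross b w := by simp [icross]; ring
  have hd1 : idot (k • b) (w - k • b) = k * idot b (w - k • b) := by simp [idot]; ring
  have hcross : 0 ≤ icross b w := by
    by_contra hlt
    push Not at hlt
    have hw0 : v + w ≠ v := by
      intro h'
      have : w = 0 := by simpa using h'
      rw [this] at hlt; simp [icross] at hlt
    have h1 := he _ hq hw0
    rw [add_sub_cancel_left] at h1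
    refine absurd (h.cross_nonneg_of_done hdone hq ?_) (not_le.2 hlt)
    obtain ⟨b1, b2⟩ := h.b_quad
    have hvb : v + b ≠ v := by
      intro h'
      have : b = 0 := by simpa using h'
      rw [this] at b2; simp [icross] at b2
    have h2 := he _ h.b_in hvb
    rw [add_sub_cancel_left] at h2
    unfold ILeftOf at h1 h2
    rw [icross_eq_of_unit h0 b w] at hlt
    rw [icross_eq_of_unit h0 e w, idot_eq_of_unit h0 e w] at h1
    rw [icross_eq_of_unit h0 e b, idot_eq_of_unit h0 e b] at h2
    unfold InQuadrant
    generalize idot a₀ w = x at *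
    generalize icross a₀ w = y at *
    generalize idot a₀ e = ex at *
    generalize icross a₀ e = ey at *
    generalize idot a₀ b = bx at *
    generalize icross a₀ b = bY at *
    -- The collinear alternative would need `e · b < 0`, impossible for two vectors of one quadrant.
    have h2' : 0 < ex * bY - ey * bx := by
      rcases h2 with h2 | ⟨-, h2⟩
      · exact h2
      · linarith [mul_nonneg e1 b1, mul_nonneg e2 b2.le]
    have hex : 0 < ex := by
      rcases e1.eq_or_lt with h | h
      · rw [← h] at h2'; linarith [mul_nonneg e2 b1]
      · exact h
    have h1' : 0 ≤ ex * y - ey * x := by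
      rcases h1 with h1 | ⟨h1, -⟩
      · exact h1.le
      · exact h1.ge
    have hx : 0 < x := by
      by_contra hx
      push Not at hx
      have h3 : bY * x ≤ 0 := mul_nonpos_of_nonneg_of_nonpos b2.le hx
      have hy : y < 0 := by
        by_contra hy
        push Not at hy
        linarith [mul_nonneg b1 hy]
      have h9 : bY * (ex * y - ey * x) = y * (ex * bY - ey * bx) + ey * (bx * y - bY * x) := by
        ring
      linarith [mul_neg_of_neg_of_pos hy h2', mul_nonpos_of_nonneg_of_nonpos e2 hlt.le,
        mul_nonneg b2.le h1']
    have hy : 0 < y := by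
      have hm := mul_nonneg e2 hx.le
      rcases lt_trichotomy y 0 with h | h | h
      · linarith [mul_neg_of_pos_of_neg hex h]
      · subst h
        rcases h1 with h1 | ⟨h1, h1''⟩
        · linarith
        · linarith [mul_pos hex hx]
      · exact h
    exact ⟨hx.le, hy⟩
  rcases hcross.eq_or_lt with h1 | h1
  · right
    refine ⟨by rw [hc1, ← h1, mul_zero], ?_⟩
    have hw := eq_basis_combo h.det w
    rw [← h1, neg_zero, zero_smul, zero_add] at hw
    set j := icross a w
    have hjk : j < k := by
      by_contra hjk
      push Not at hjk
      rcases hjk.eq_or_lt with hjk | hjk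
      · rw [hjk, ← hw] at hne; exact hne rfl
      · rw [hw] at hq
        exact hmax (inDisk_of_between h.mem hq (by omega) (by omega))
    have hbb : 0 < idot b b := by
      rcases (idot_self_nonneg b).eq_or_lt with h2 | h2
      · exfalso
        have hb2 := h.b_quad.2
        simp only [idot] at h2
        have z1 : b.1 = 0 := by nlinarith [sq_nonneg b.1, sq_nonneg b.2]
        have z2 : b.2 = 0 := by nlinarith [sq_nonneg b.1, sq_nonneg b.2]
        simp [icross, z1, z2] at hb2
      · exact h2
    have : idot b (w - k • b) = (j - k) * idot b b := by
      rw [hw]; simp [idot]; ring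
    rw [hd1, this]
    have hk0 : 0 < k := by omega
    have : (j - k) * idot b b < 0 := mul_neg_of_neg_of_pos (by omega) hbb
    exact mul_neg_of_pos_of_neg hk0 this
  · left
    rw [hc1]
    exact mul_pos (by omega) h1

/-- If neither of two orthogonal unit steps stays in the disk, then no lattice point of their
quadrant does. -/
theorem not_inDisk_of_units {c : Plane} {r : ℝ} {v a₀ w : ℤ × ℤ} (h0 : idot a₀ a₀ = 1)
    (hv : InDisk c r v) (ha : ¬ InDisk c r (v + a₀)) (hb : ¬ InDisk c r (v + irot a₀))
    (hx : 0 ≤ idot a₀ w) (hy : 0 ≤ icross a₀ w) (hw0 : w ≠ 0) : ¬ InDisk c r (v + w) := by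
  intro hw
  have hw' := unit_cases h0 w
  set x := idot a₀ w with hxd
  set y := icross a₀ w with hyd
  have hxy : 1 ≤ x + y := by
    by_contra hlt
    have x0 : x = 0 := by omega
    have y0 : y = 0 := by omega
    rw [x0, y0] at hw'
    apply hw0; simpa using hw'
  rw [hw'] at hw
  simp only [InDisk, OnDisk, irot, not_le, Prod.fst_add, Prod.snd_add, Prod.smul_fst, Prod.smul_snd,
    smul_eq_mul, Int.cast_add, Int.cast_mul, Int.cast_neg] at hv ha hb hw
  have hu : (a₀.1 : ℝ) * a₀.1 + a₀.2 * a₀.2 = 1 := by exact_mod_cast h0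
  -- With `P, Q` the components of `v - c` along the two units and `ρ = r² - |v - c|² ≥ 0`, the
  -- hypotheses read `1 + 2 P > ρ` and `1 + 2 Q > ρ`. By integrality `x² + y² + 2 x P + 2 y Q ≥ x (1
  -- + 2 P) + y (1 + 2 Q) > (x + y) ρ ≥ ρ`. This uses the roundness of the disk: a thin convex set
  -- along a diagonal violates the claim.
  have hx1 : (x : ℝ) ≤ x * x := by exact_mod_cast (by nlinarith : x ≤ x * x)
  have hy1 : (y : ℝ) ≤ y * y := by exact_mod_cast (by nlinarith : y ≤ y * y)
  have hx' : (0 : ℝ) ≤ x := by exact_mod_cast hx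
  have hy' : (0 : ℝ) ≤ y := by exact_mod_cast hy
  have hxy' : (1 : ℝ) ≤ x + y := by exact_mod_cast hxy
  clear_value x y
  generalize (x : ℝ) = X at *
  generalize (y : ℝ) = Y at *
  generalize (a₀.1 : ℝ) = α at *
  generalize (a₀.2 : ℝ) = β at *
  set p := (v.1 : ℝ) - c 0 with hp
  set q := (v.2 : ℝ) - c 1 with hq
  have hX : 1 + 2 * (α * p + β * q) > r ^ 2 - p ^ 2 - q ^ 2 := by nlinarith
  have hY : 1 + 2 * (-β * p + α * q) > r ^ 2 - p ^ 2 - q ^ 2 := by nlinarith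
  have hW : X * X + Y * Y + 2 * X * (α * p + β * q) + 2 * Y * (-β * p + α * q)
      ≤ r ^ 2 - p ^ 2 - q ^ 2 := by
    have : (v.1 + (X * α + Y * -β) - c 0) ^ 2 + (v.2 + (X * β + Y * α) - c 1) ^ 2 =
      p ^ 2 + q ^ 2 + (X * X + Y * Y) * (α * α + β * β) + 2 * X * (α * p + β * q)
        + 2 * Y * (-β * p + α * q) := by rw [hp, hq]; ring
    rw [this, hu] at hw
    linarith
  have hρ : 0 ≤ r ^ 2 - p ^ 2 - q ^ 2 := by linarith
  set ρ := r ^ 2 - p ^ 2 - q ^ 2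
  set P := α * p + β * q
  set Q := -β * p + α * q
  rcases hx'.eq_or_lt with h | h
  · nlinarith
  · nlinarith

/-- Both unit steps leave the disk, so the closed quadrant at `v` holds no further lattice point of
it, and the supporting line can turn freely from `e` to `irot a₀`. Hence testing the single point `v
+ irot a₀` tells when a quadrant is finished. -/
theorem Supports.next_quadrant {c : Plane} {r : ℝ} {v e a₀ : ℤ × ℤ} (h0 : idot a₀ a₀ = 1)
    (hv : InDisk c r v) (he : Supports c r e v) (e1 : 0 ≤ idot a₀ e) (e2 : 0 ≤ icross a₀ e)
    (e0 : e ≠ 0) (hb : ¬ InDisk c r (v + irot a₀)) : Supports c r (irot a₀) v := by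
  intro q hq hne
  have h1 := he q hq hne
  have ha := not_inDisk_add_unit h0 he e1 e2
  obtain ⟨w, rfl⟩ : ∃ w, q = v + w := ⟨q - v, by abel⟩
  have hw0 : w ≠ 0 := by rintro rfl; simp at hne
  rw [add_sub_cancel_left] at *
  have h2 := fun hx hy => not_inDisk_of_units h0 hv ha hb hx hy hw0 hq
  unfold ILeftOf at *
  rw [icross_irot, idot_irot]
  have e0' : ¬ (idot a₀ e = 0 ∧ icross a₀ e = 0) := by
    rintro ⟨h3, h4⟩
    apply e0
    rw [unit_cases h0 e, h3, h4]; simp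
  rw [icross_eq_of_unit h0 e w, idot_eq_of_unit h0 e w] at h1
  generalize idot a₀ w = x at *
  generalize icross a₀ w = y at *
  generalize idot a₀ e = ex at *
  generalize icross a₀ e = ey at *
  by_contra hcon
  push Not at hcon
  have hx : 0 ≤ x := by linarith [hcon.1]
  have hy : y < 0 := by
    by_contra hy
    exact h2 hx (by omega)
  have hx' : 0 < x := by
    rcases hx.eq_or_lt with h | h
    · have := hcon.2 (by omega); omega
    · exact h
  have m1 : ex * y ≤ 0 := mul_nonpos_of_nonneg_of_nonpos e1 hy.le
  have m2 : 0 ≤ ey * x := mul_nonneg e2 hx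
  rcases h1 with h1 | ⟨h1, -⟩
  · linarith
  · have m3 : ex * y = 0 := by linarith
    have m4 : ey * x = 0 := by linarith
    exact e0' ⟨by rcases mul_eq_zero.1 m3 with h | h; exact h; omega,
      by rcases mul_eq_zero.1 m4 with h | h; exact h; omega⟩

/-! ### Counting the edges in a quadrant, and the number of search rounds. -/

/-- The displacement vectors along a walk. -/
def walkSteps : ℤ × ℤ → List (ℤ × ℤ) → List (ℤ × ℤ)
  | _, [] => []
  | v, q :: l => (q - v) :: walkSteps q l

/-- A step to a vertex along a supporting line whose direction lies in the quadrant of `a₀`. -/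
def QuadrantStep (c : Plane) (r : ℝ) (a₀ p q : ℤ × ℤ) : Prop :=
  InDisk c r q ∧ Supports c r (q - p) q ∧ InQuadrant a₀ (q - p)

theorem length_walkSteps (v : ℤ × ℤ) (l : List (ℤ × ℤ)) :
    (walkSteps v l).length = l.length := by
  induction l generalizing v with
  | nil => rfl
  | cons q l ih => simp [walkSteps, ih]

theorem InQuadrant.ne_zero {a₀ u : ℤ × ℤ} (h : InQuadrant a₀ u) : u ≠ 0 := by
  rintro rfl
  have := h.2
  simp [icross] at this

theorem InQuadrant.cross_pos {a₀ u w : ℤ × ℤ} (h0 : idot a₀ a₀ = 1) (hu : InQuadrant a₀ u)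
    (hw : InQuadrant a₀ w) (h : ILeftOf u w) : 0 < icross u w := by
  rcases h with h | ⟨-, h⟩
  · exact h
  · rw [idot_eq_of_unit h0 u w] at h
    linarith [mul_nonneg hu.1 hw.1, mul_nonneg hu.2.le hw.2.le]

theorem InQuadrant.cross_trans {a₀ u w z : ℤ × ℤ} (h0 : idot a₀ a₀ = 1) (hu : InQuadrant a₀ u)
    (hw : InQuadrant a₀ w) (hz : InQuadrant a₀ z) (h1 : 0 < icross u w) (h2 : 0 < icross w z) :
    0 < icross u z := by
  rw [icross_eq_of_unit h0] at *
  obtain ⟨u1, u2⟩ := hu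
  obtain ⟨w1, w2⟩ := hw
  obtain ⟨z1, z2⟩ := hz
  generalize idot a₀ u = ux at *
  generalize icross a₀ u = uy at *
  generalize idot a₀ w = wx at *
  generalize icross a₀ w = wy at *
  generalize idot a₀ z = zx at *
  generalize icross a₀ z = zy at *
  have : wy * (ux * zy - uy * zx) = zy * (ux * wy - uy * wx) + uy * (wx * zy - wy * zx) := by ring
  have h3 : 0 < wy * (ux * zy - uy * zx) := by
    rw [this]; exact add_pos (mul_pos z2 h1) (mul_pos u2 h2)
  exact pos_of_mul_pos_right h3 w2.le

theorem walkSteps_quadrant {c : Plane} {r : ℝ} {a₀ v : ℤ × ℤ} {l : List (ℤ × ℤ)}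
    (hl : List.IsChain (QuadrantStep c r a₀) (v :: l)) : ∀ u ∈ walkSteps v l, InQuadrant a₀ u := by
  induction l generalizing v with
  | nil => simp [walkSteps]
  | cons q l ih =>
    rw [List.isChain_cons_cons] at hl
    intro u hu
    simp only [walkSteps, List.mem_cons] at hu
    rcases hu with rfl | hu
    · exact hl.1.2.2
    · exact ih hl.2 u hu

/-- Consecutive edges turn strictly left, and inside a quadrant this relation is transitive; in
particular the edge vectors are distinct. -/
theorem walkSteps_pairwise {c : Plane} {r : ℝ} {a₀ v : ℤ × ℤ} (h0 : idot a₀ a₀ = 1)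
    {l : List (ℤ × ℤ)} (hl : List.IsChain (QuadrantStep c r a₀) (v :: l)) :
    (walkSteps v l).Pairwise (fun u w => 0 < icross u w) ∧
      ∀ e, InQuadrant a₀ e → Supports c r e v → ∀ u ∈ walkSteps v l, 0 < icross e u := by
  induction l generalizing v with
  | nil => simp [walkSteps]
  | cons q l ih =>
    rw [List.isChain_cons_cons] at hl
    obtain ⟨⟨hq, hs, hquad⟩, hl⟩ := hl
    obtain ⟨i1, i2⟩ := ih hl
    simp only [walkSteps, List.pairwise_cons]
    refine ⟨⟨i2 _ hquad hs, i1⟩, ?_⟩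
    intro e he hsup u hu
    have hne : q ≠ v := fun h => hquad.ne_zero (sub_eq_zero.2 h)
    have h1 := he.cross_pos h0 hquad (hsup q hq hne)
    rcases List.mem_cons.1 hu with rfl | hu
    · exact h1
    · exact he.cross_trans h0 hquad (walkSteps_quadrant hl u hu) h1 (i2 _ hquad hs u hu)

theorem walkSteps_sum {v w : ℤ × ℤ} {l : List (ℤ × ℤ)} (hw : (v :: l).getLast? = some w) :
    (walkSteps v l).sum = w - v := by
  induction l generalizing v with
  | nil => simp at hw; simp [walkSteps, hw]
  | cons q l ih =>
    rw [List.getLast?_cons_cons] at hw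
    simp [walkSteps, ih hw]

theorem idot_sub_le {c : Plane} {r : ℝ} {p q : ℤ × ℤ} (hp : InDisk c r p) (hq : InDisk c r q) :
    (idot (q - p) (q - p) : ℝ) ≤ 4 * r ^ 2 := by
  simp only [InDisk, OnDisk, idot] at *
  push_cast [Prod.fst_sub, Prod.snd_sub]
  nlinarith [sq_nonneg ((p.1 : ℝ) - c 0 + (q.1 - c 0)), sq_nonneg ((p.2 : ℝ) - c 1 + (q.2 - c 1))]

theorem inDisk_of_isChain {c : Plane} {r : ℝ} {a₀ v : ℤ × ℤ} {l : List (ℤ × ℤ)}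
    (hl : List.IsChain (QuadrantStep c r a₀) (v :: l)) : ∀ q ∈ l, InDisk c r q := by
  induction l generalizing v with
  | nil => simp
  | cons q l ih =>
    rw [List.isChain_cons_cons] at hl
    intro w hw
    rcases List.mem_cons.1 hw with rfl | hw
    · exact hl.1.1
    · exact ih hl.2 w hw

/-- Vectors of ℓ¹ norm at most `s` fit into a box of `(s + 1)²` points; each of the others uses up
more than `s` of the total `B`. -/
theorem card_le_of_sum_le (S : Finset (ℤ × ℤ)) (hS : ∀ u ∈ S, 0 ≤ u.1 ∧ 0 ≤ u.2) {s : ℕ}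
    (hs : 1 ≤ s) {B : ℝ} (hB : ((∑ u ∈ S, (u.1 + u.2) : ℤ) : ℝ) ≤ B) :
    (S.card : ℝ) ≤ (s + 1) ^ 2 + B / s := by
  have hs0 : (0 : ℝ) < s := by exact_mod_cast hs
  rw [← Finset.card_filter_add_card_filter_not (s := S) (fun u => u.1 + u.2 ≤ (s : ℤ)), Nat.cast_add]
  apply add_le_add
  · have h1 : (S.filter (fun u => u.1 + u.2 ≤ (s : ℤ))) ⊆
        (Finset.Icc (0 : ℤ) s) ×ˢ (Finset.Icc (0 : ℤ) s) := by
      intro u hu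
      rw [Finset.mem_filter] at hu
      have := hS u hu.1
      simp only [Finset.mem_product, Finset.mem_Icc]
      omega
    have h2 := Finset.card_le_card h1
    rw [Finset.card_product, Int.card_Icc] at h2
    have h3 : ((s : ℤ) + 1 - 0).toNat = s + 1 := by omega
    rw [h3] at h2
    rw [sq]
    exact_mod_cast h2
  · rw [le_div_iff₀ hs0]
    refine le_trans ?_ hB
    have h1 : ∑ u ∈ S.filter (fun u => ¬ u.1 + u.2 ≤ (s : ℤ)), (s : ℤ)
        ≤ ∑ u ∈ S.filter (fun u => ¬ u.1 + u.2 ≤ (s : ℤ)), (u.1 + u.2) := by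
      apply Finset.sum_le_sum
      intro u hu
      rw [Finset.mem_filter] at hu
      omega
    have h2 : ∑ u ∈ S.filter (fun u => ¬ u.1 + u.2 ≤ (s : ℤ)), (u.1 + u.2) ≤ ∑ u ∈ S, (u.1 + u.2) := by
      apply Finset.sum_le_sum_of_subset_of_nonneg (Finset.filter_subset _ _)
      intro u hu _
      have := hS u hu
      omega
    rw [Finset.sum_const, nsmul_eq_mul] at h1
    exact_mod_cast h1.trans h2

/-- In the orthonormal coordinates of the quadrant the edge vectors are nonnegative and add up to a
displacement within the disk, whose two coordinates are at most `2 r` each. -/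
theorem length_le_of_isChain_quadrantStep {c : Plane} {r : ℝ} (hr : 0 < r) {a₀ v : ℤ × ℤ}
    (h0 : idot a₀ a₀ = 1) {l : List (ℤ × ℤ)} (hv : InDisk c r v)
    (hl : List.IsChain (QuadrantStep c r a₀) (v :: l)) :
    (l.length : ℝ) ≤ 13 * (max r 2) ^ (2 / 3 : ℝ) := by
  set f : ℤ × ℤ → ℤ × ℤ := fun u => (idot a₀ u, icross a₀ u) with hf
  have hadd : ∀ x y, idot a₀ (x + y) = idot a₀ x + idot a₀ y := fun x y => by simp [idot]; ring
  have hadd' : ∀ x y, icross a₀ (x + y) = icross a₀ x + icross a₀ y := fun x y => by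
    simp [icross]; ring
  have finj : Function.Injective f := by
    intro x y hxy
    rw [unit_cases h0 x, unit_cases h0 y]
    simp only [hf, Prod.mk.injEq] at hxy
    rw [hxy.1, hxy.2]
  have hnd : (walkSteps v l).Nodup := by
    refine (walkSteps_pairwise h0 hl).1.imp ?_
    rintro a b hab rfl
    rw [icross_self] at hab; exact lt_irrefl _ hab
  have hquad := walkSteps_quadrant hl
  obtain ⟨w, hw⟩ : ∃ w, (v :: l).getLast? = some w := ⟨_, List.getLast?_eq_getLast_of_ne_nil (by simp)⟩
  have hwD : InDisk c r w := by
    have hmem := List.mem_of_getLast? hw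
    rcases List.mem_cons.1 hmem with rfl | hmem
    · exact hv
    · exact inDisk_of_isChain hl w hmem
  have hsum := walkSteps_sum hw
  have hsum' : ∀ L : List (ℤ × ℤ), (L.map (fun u => (f u).1 + (f u).2)).sum
      = idot a₀ L.sum + icross a₀ L.sum := by
    intro L
    induction L with
    | nil => simp [idot, icross]
    | cons x L ih =>
      rw [List.map_cons, List.sum_cons, ih, List.sum_cons, hadd, hadd']; ring
  have hB : ((∑ u ∈ (walkSteps v l).toFinset.image f, (u.1 + u.2) : ℤ) : ℝ) ≤ 4 * r := by
    rw [Finset.sum_image (fun x _ y _ h => finj h), List.sum_toFinset _ hnd, hsum', hsum]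
    have h1 := idot_sub_le hv hwD
    rw [idot_eq_of_unit h0] at h1
    push_cast at h1 ⊢
    generalize ((idot a₀ (w - v) : ℤ) : ℝ) = x at *
    generalize ((icross a₀ (w - v) : ℤ) : ℝ) = y at *
    have hx : x ≤ 2 * r := by nlinarith [sq_nonneg y]
    have hy : y ≤ 2 * r := by nlinarith [sq_nonneg x]
    linarith
  have hlen : ((walkSteps v l).toFinset.image f).card = l.length := by
    rw [Finset.card_image_of_injective _ finj, List.toFinset_card_of_nodup hnd, length_walkSteps]
  have hS : ∀ u ∈ (walkSteps v l).toFinset.image f, 0 ≤ u.1 ∧ 0 ≤ u.2 := by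
    intro u hu
    rw [Finset.mem_image] at hu
    obtain ⟨z, hz, rfl⟩ := hu
    have := hquad z (List.mem_toFinset.1 hz)
    exact ⟨this.1, this.2.le⟩
  set ρ := max r 2 with hρ
  have hρ2 : 2 ≤ ρ := le_max_right _ _
  have hρr : r ≤ ρ := le_max_left _ _
  have hρ0 : 0 < ρ := by linarith
  set x := ρ ^ (1 / 3 : ℝ) with hx
  have hx1 : 1 ≤ x := Real.one_le_rpow (by linarith) (by norm_num)
  have hx2 : ρ ^ (2 / 3 : ℝ) = x ^ 2 := by
    rw [hx, ← Real.rpow_natCast, ← Real.rpow_mul hρ0.le]; norm_num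
  have hx3 : ρ = x ^ 3 := by
    rw [hx, ← Real.rpow_natCast, ← Real.rpow_mul hρ0.le]; norm_num
  have hs1 : x ≤ ⌈x⌉₊ := Nat.le_ceil x
  have hs2 : (⌈x⌉₊ : ℝ) < x + 1 := Nat.ceil_lt_add_one (by linarith)
  -- With `x = ρ^(1/3)` the two terms are at most `9 x²` and `4 x²`, whence the constant `13`.
  have key := card_le_of_sum_le _ hS (s := ⌈x⌉₊) (by exact_mod_cast hx1.trans hs1) hB
  rw [hlen] at key
  rw [hx2]
  have k1 : (4 * r) / (⌈x⌉₊ : ℝ) ≤ 4 * x ^ 2 := by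
    rw [div_le_iff₀ (by linarith)]
    have : 4 * x ^ 2 * x ≤ 4 * x ^ 2 * (⌈x⌉₊ : ℝ) := by gcongr
    nlinarith
  have k2 : ((⌈x⌉₊ : ℝ) + 1) ^ 2 ≤ 9 * x ^ 2 := by
    have : (⌈x⌉₊ : ℝ) + 1 ≤ 3 * x := by linarith
    calc ((⌈x⌉₊ : ℝ) + 1) ^ 2 ≤ (3 * x) ^ 2 := by gcongr
      _ = 9 * x ^ 2 := by ring
  linarith

/-- A logarithmic number of quadruplings exceeds `4 r²`. -/
theorem exists_pow_gt (r : ℝ) (hr : 0 < r) :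
    ∃ n : ℕ, 4 * r ^ 2 < 4 ^ n ∧ (n : ℝ) + 1 ≤ 6 * Real.log (max r 2) := by
  set ρ := max r 2 with hρ
  have hρ2 : 2 ≤ ρ := le_max_right _ _
  have hρr : r ≤ ρ := le_max_left _ _
  have hl2 := Real.log_two_gt_d9
  have hlρ : Real.log 2 ≤ Real.log ρ := Real.log_le_log (by norm_num) hρ2
  have hq : 0 ≤ Real.log ρ / Real.log 2 := div_nonneg (by linarith) (by linarith)
  -- This exponent makes `2 ^ n > 2 ρ`. As `log₂ ρ ≥ 1`, `log₂ ρ + 3 ≤ 4 log₂ ρ`, and `4 / log 2 <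
  -- 6`.
  refine ⟨⌊Real.log ρ / Real.log 2⌋₊ + 2, ?_, ?_⟩
  · set k := ⌊Real.log ρ / Real.log 2⌋₊
    have h1 : Real.log ρ / Real.log 2 < k + 1 := Nat.lt_floor_add_one _
    rw [div_lt_iff₀ (by linarith)] at h1
    have h2 : ρ < 2 ^ (k + 1) := by
      rw [← Real.log_lt_log_iff (by linarith) (by positivity), Real.log_pow]
      push_cast; exact h1
    have h3 : 2 * r < 2 ^ (k + 2) := by rw [pow_succ]; linarith
    calc 4 * r ^ 2 = (2 * r) ^ 2 := by ring
      _ < (2 ^ (k + 2)) ^ 2 := by gcongr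
      _ = 4 ^ (k + 2) := by rw [← pow_mul, mul_comm, pow_mul]; norm_num
  · have h1 : (⌊Real.log ρ / Real.log 2⌋₊ : ℝ) ≤ Real.log ρ / Real.log 2 := Nat.floor_le hq
    have h2 : Real.log ρ / Real.log 2 + 3 ≤ 6 * Real.log ρ := by
      rw [← le_sub_iff_add_le, div_le_iff₀ (by linarith)]
      nlinarith
    push_cast
    linarith

/-! ### Rules for reasoning about runs, and the space bound. -/

namespace RealRAM

/-- From memory `m` and output `o`, the program halts, and `R` holds of its number of steps, its final
memory and its final output. -/
def Runs (C : Set Plane) (P : Prog) (m : ℕ → ℝ) (o : List Plane)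
    (R : ℕ → (ℕ → ℝ) → List Plane → Prop) : Prop :=
  ∀ s : State, s.mem = m → s.out = o → ∃ t s', Exec C P s t s' ∧ R t s'.mem s'.out

section Rules

variable {C : Set Plane} {P Q : Prog} {m : ℕ → ℝ} {o : List Plane}
  {R R' : ℕ → (ℕ → ℝ) → List Plane → Prop}

theorem Runs.mono (h : Runs C P m o R) (hR : ∀ t m' o', R t m' o' → R' t m' o') :
    Runs C P m o R' := fun s hm ho =>
  let ⟨t, s', he, hr⟩ := h s hm ho
  ⟨t, s', he, hR _ _ _ hr⟩

theorem runs_skip (h : R 0 m o) : Runs C .skip m o R := by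
  rintro s rfl rfl
  exact ⟨0, s, .skip s, h⟩

theorem runs_seq (h : Runs C P m o fun t m' o' => Runs C Q m' o' fun t' => R (t + t')) :
    Runs C (.seq P Q) m o R := by
  intro s hm ho
  obtain ⟨t, s', he, hr⟩ := h s hm ho
  obtain ⟨t', s'', he', hr'⟩ := hr s' rfl rfl
  exact ⟨t + t', s'', .seq he he', hr'⟩

theorem runs_branch {i j : ℕ} (h₁ : m i ≤ m j → Runs C P m o fun t => R (t + 1))
    (h₂ : ¬ m i ≤ m j → Runs C Q m o fun t => R (t + 1)) : Runs C (.branch i j P Q) m o R := by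
  rintro s rfl rfl
  by_cases h : s.mem i ≤ s.mem j
  · obtain ⟨t, s', he, hr⟩ := h₁ h (touch i j s) rfl rfl
    exact ⟨t + 1, s', .branch_true h he, hr⟩
  · obtain ⟨t, s', he, hr⟩ := h₂ h (touch i j s) rfl rfl
    exact ⟨t + 1, s', .branch_false h he, hr⟩

theorem runs_loop {i j : ℕ} (h₁ : ¬ m i ≤ m j → R 1 m o)
    (h₂ : m i ≤ m j → Runs C P m o fun t m' o' =>
      Runs C (.loop i j P) m' o' fun t' => R (t + t' + 1)) : Runs C (.loop i j P) m o R := by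
  rintro s rfl rfl
  by_cases h : s.mem i ≤ s.mem j
  · obtain ⟨t, s', he, hr⟩ := h₂ h (touch i j s) rfl rfl
    obtain ⟨t', s'', he', hr'⟩ := hr s' rfl rfl
    exact ⟨t + t' + 1, s'', .loop_step h he he', hr'⟩
  · exact ⟨1, touch i j s, Exec.loop_stop h, h₁ h⟩

/-- Straight-line code. -/
def block : List Instr → Prog
  | [] => .skip
  | a :: l => .seq (.instr a) (block l)

/-- The memory after straight-line code. -/
noncomputable def memAfter (C : Set Plane) : List Instr → (ℕ → ℝ) → (ℕ → ℝ)
  | [], m => m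
  | a :: l, m => memAfter C l (a.newMem C m)

/-- The output of straight-line code. -/
noncomputable def outAfter (C : Set Plane) : List Instr → (ℕ → ℝ) → List Plane
  | [], _ => []
  | a :: l, m => a.newOut m ++ outAfter C l (a.newMem C m)

theorem runs_block (l : List Instr)
    (h : R l.length (memAfter C l m) (o ++ outAfter C l m)) : Runs C (block l) m o R := by
  induction l generalizing m o R with
  | nil => simp only [outAfter, List.append_nil] at h; exact runs_skip h
  | cons a l ih =>
    apply runs_seq
    rintro s rfl rfl
    refine ⟨1, _, .instr a s, ih ?_⟩
    simp only [List.length_cons, outAfter, memAfter, ← List.append_assoc] at h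
    rw [Nat.add_comm]
    exact h

end Rules

/-- All the cells that a program can access have an address less than `n`; there is no indirect
addressing. -/
def Prog.StaticBelow (n : ℕ) : Prog → Prop
  | .skip => True
  | .instr (.load _ _) => False
  | .instr (.store _ _) => False
  | .instr a => a.cells 0 ⊆ Finset.range n
  | .seq P Q => P.StaticBelow n ∧ Q.StaticBelow n
  | .branch i j P Q => i < n ∧ j < n ∧ P.StaticBelow n ∧ Q.StaticBelow n
  | .loop i j P => i < n ∧ j < n ∧ P.StaticBelow n

theorem touch_subset {i j n : ℕ} (hi : i < n) (hj : j < n) {s : State}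
    (hs : s.used ⊆ Finset.range n) : (touch i j s).used ⊆ Finset.range n := by
  simp only [touch]
  apply Finset.union_subset hs
  intro x hx
  simp only [Finset.mem_insert, Finset.mem_singleton] at hx
  rcases hx with rfl | rfl <;> simpa

/-- Without indirect addressing, every accessed cell is named in the program, so space is bounded
syntactically and can be left out of `Runs`. -/
theorem Exec.used_subset {C : Set Plane} {n : ℕ} {P : Prog} {s s' : State} {t : ℕ}
    (h : Exec C P s t s') (hP : P.StaticBelow n) (hs : s.used ⊆ Finset.range n) :
    s'.used ⊆ Finset.range n := by
  induction h with
  | skip s => exact hs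
  | instr a s =>
    apply Finset.union_subset hs
    cases a <;> first | exact hP | exact hP.elim
  | seq _ _ ih₁ ih₂ => exact ih₂ hP.2 (ih₁ hP.1 hs)
  | branch_true _ _ ih => exact ih hP.2.2.1 (touch_subset hP.1 hP.2.1 hs)
  | branch_false _ _ ih => exact ih hP.2.2.2 (touch_subset hP.1 hP.2.1 hs)
  | loop_stop _ => exact touch_subset hP.1 hP.2.1 hs
  | loop_step _ _ _ ih₁ ih₂ =>
    exact ih₂ hP (ih₁ hP.2.2 (touch_subset hP.1 hP.2.1 hs))

/-! ### Chords -/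

theorem mem_closedBall_iff {c : Plane} {r : ℝ} (hr : 0 < r) (q : Plane) :
    q ∈ Metric.closedBall c r ↔ OnDisk c r (q 0) (q 1) := by
  rw [Metric.mem_closedBall, EuclideanSpace.dist_eq, Real.sqrt_le_left hr.le]
  simp [OnDisk, Fin.sum_univ_two, Real.dist_eq, sq_abs]

theorem lineParams_iff {c p d : Plane} {r : ℝ} (hr : 0 < r) (hd : d ≠ 0) (t : ℝ) :
    t ∈ lineParams (Metric.closedBall c r) p d ↔
      OnDisk c r (p 0 + t * d 0) (p 1 + t * d 1) := by
  simp only [lineParams, Set.mem_ofPred_eq, mem_closedBall_iff hr]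
  simp [hd]

/-- The parameter set is closed, bounded and convex in `ℝ`, so the machine's `sInf` and `sSup` are
attained endpoints. -/
theorem lineParams_eq_Icc {c p d : Plane} {r : ℝ} (hd : d ≠ 0)
    (hT : (lineParams (Metric.closedBall c r) p d).Nonempty) :
    lineParams (Metric.closedBall c r) p d =
      Set.Icc (sInf (lineParams (Metric.closedBall c r) p d))
        (sSup (lineParams (Metric.closedBall c r) p d)) := by
  have e : lineParams (Metric.closedBall c r) p d =
      (fun t : ℝ => p + t • d) ⁻¹' Metric.closedBall c r := by
    ext t; simp [lineParams, hd]
  have hcl : IsClosed (lineParams (Metric.closedBall c r) p d) := by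
    rw [e]; exact Metric.isClosed_closedBall.preimage (by fun_prop)
  have hbd : Bornology.IsBounded (lineParams (Metric.closedBall c r) p d) := by
    have hd' : 0 < ‖d‖ := norm_pos_iff.2 hd
    refine (Metric.isBounded_closedBall (x := (0 : ℝ)) (r := (r + ‖p - c‖) / ‖d‖)).subset ?_
    intro t ht
    rw [e, Set.mem_preimage, Metric.mem_closedBall, dist_eq_norm] at ht
    rw [Metric.mem_closedBall, dist_zero_right, le_div_iff₀ hd', ← norm_smul]
    calc ‖t • d‖ = ‖(p + t • d - c) - (p - c)‖ := by congr 1; abel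
      _ ≤ ‖p + t • d - c‖ + ‖p - c‖ := norm_sub_le _ _
      _ ≤ r + ‖p - c‖ := by gcongr
  have hcomp := Metric.isCompact_of_isClosed_isBounded hcl hbd
  have hconv : Convex ℝ (lineParams (Metric.closedBall c r) p d) := by
    rw [e]
    intro x hx y hy s t hs ht hst
    have h := (convex_closedBall c r) hx hy hs ht hst
    simp only [Set.mem_preimage] at *
    convert h using 1
    have : p = (s + t) • p := by rw [hst, one_smul]
    nth_rewrite 1 [this]
    simp only [smul_add, add_smul, smul_smul, smul_eq_mul]
    abel
  apply Set.Subset.antisymm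
  · exact subset_Icc_csInf_csSup hcomp.bddBelow hcomp.bddAbove
  · exact hconv.ordConnected.out (hcomp.sInf_mem hT) (hcomp.sSup_mem hT)

/-- The parameters `t` for which the point `(px, py) + t (dx, dy)` lies in the disk are those between
`t₀` and `t₁`. -/
def Chord (c : Plane) (r px py dx dy t₀ t₁ : ℝ) : Prop :=
  ∀ t, t₀ ≤ t ∧ t ≤ t₁ ↔ OnDisk c r (px + t * dx) (py + t * dy)

/-- The code that computes the chord parameters for the line through the point in cells `20, 21` with
direction in cells `22, 23`, and puts them into the cells `24, 25`. -/
def chordCode : List Instr :=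
  [.add 26 20 3, .add 27 21 3, .sub 28 20 22, .sub 29 21 23,
    .line 30 26 27 28 29 20 21 22 23,
    .mul 31 22 22, .mul 32 23 23, .add 31 31 32,
    .sub 26 26 20, .sub 27 27 21, .mul 26 26 22, .mul 27 27 23, .add 26 26 27, .div 24 26 31,
    .sub 28 28 20, .sub 29 29 21, .mul 28 28 22, .mul 29 29 23, .add 28 28 29, .div 25 28 31]

/-- The parameter of a point `q` on the line is recovered as `(q - p) · d / (d · d)`. -/
theorem memAfter_chordCode {c : Plane} {r : ℝ} (hr : 0 < r) {m : ℕ → ℝ} (h3 : m 3 = 0)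
    (hd : m 22 ≠ 0 ∨ m 23 ≠ 0) :
    (∀ i < 24, memAfter (Metric.closedBall c r) chordCode m i = m i) ∧
      Chord c r (m 20) (m 21) (m 22) (m 23)
        (memAfter (Metric.closedBall c r) chordCode m 24)
        (memAfter (Metric.closedBall c r) chordCode m 25) := by
  have hd' : pointAt m 22 23 ≠ 0 := by
    intro h
    have h0 := congrArg (fun q : Plane => q 0) h
    have h1 := congrArg (fun q : Plane => q 1) h
    simp [pointAt] at h0 h1
    tauto
  have hN : m 22 * m 22 + m 23 * m 23 ≠ 0 := by
    intro h
    have h1 : m 22 = 0 := by nlinarith [mul_self_nonneg (m 22), mul_self_nonneg (m 23)]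
    have h2 : m 23 = 0 := by nlinarith [mul_self_nonneg (m 22), mul_self_nonneg (m 23)]
    tauto
  have hiff := lineParams_iff (c := c) (p := pointAt m 20 21) hr hd'
  set T := lineParams (Metric.closedBall c r) (pointAt m 20 21) (pointAt m 22 23) with hTdef
  set m₁ : ℕ → ℝ := write 29 (m 21 - m 23) (write 28 (m 20 - m 22)
      (write 27 (m 21) (write 26 (m 20) m))) with hm₁
  have hlow : ∀ i < 24, m₁ i = m i := by
    intro i hi
    simp [hm₁, write, Function.update, show i ≠ 26 by omega, show i ≠ 27 by omega,
      show i ≠ 28 by omega, show i ≠ 29 by omega]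
  have hsplit : memAfter (Metric.closedBall c r) chordCode m =
      memAfter (Metric.closedBall c r) (chordCode.drop 5)
        ((Instr.line 30 26 27 28 29 20 21 22 23).newMem (Metric.closedBall c r) m₁) := by
    have h : m₁ = memAfter (Metric.closedBall c r) (chordCode.take 4) m := by
      simp [chordCode, memAfter, Instr.newMem, hm₁, write, Function.update, h3]
    rw [h]
    rfl
  have hp : pointAt m₁ 20 21 = pointAt m 20 21 := by simp [pointAt, hlow]
  have hp' : pointAt m₁ 22 23 = pointAt m 22 23 := by simp [pointAt, hlow]
  have hrest : ∀ m₂ : ℕ → ℝ, (∀ i < 24, memAfter (Metric.closedBall c r) (chordCode.drop 5) m₂ i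
        = m₂ i) ∧
      memAfter (Metric.closedBall c r) (chordCode.drop 5) m₂ 24 =
        ((m₂ 26 - m₂ 20) * m₂ 22 + (m₂ 27 - m₂ 21) * m₂ 23) / (m₂ 22 * m₂ 22 + m₂ 23 * m₂ 23) ∧
      memAfter (Metric.closedBall c r) (chordCode.drop 5) m₂ 25 =
        ((m₂ 28 - m₂ 20) * m₂ 22 + (m₂ 29 - m₂ 21) * m₂ 23)
          / (m₂ 22 * m₂ 22 + m₂ 23 * m₂ 23) := by
    intro m₂
    refine ⟨fun i hi => ?_, ?_, ?_⟩
    · simp [chordCode, memAfter, Instr.newMem, write, Function.update, show i ≠ 24 by omega,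
        show i ≠ 25 by omega, show i ≠ 26 by omega, show i ≠ 27 by omega,
        show i ≠ 28 by omega, show i ≠ 29 by omega, show i ≠ 31 by omega, show i ≠ 32 by omega]
    · simp [chordCode, memAfter, Instr.newMem, write, Function.update]
    · simp [chordCode, memAfter, Instr.newMem, write, Function.update]
  rw [hsplit]
  by_cases hT : T.Nonempty
  · have hIcc := lineParams_eq_Icc hd' hT
    rw [← hTdef] at hIcc
    have e : memAfter (Metric.closedBall c r) (chordCode.drop 5)
        ((Instr.line 30 26 27 28 29 20 21 22 23).newMem (Metric.closedBall c r) m₁) 24 = sInf T ∧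
        memAfter (Metric.closedBall c r) (chordCode.drop 5)
        ((Instr.line 30 26 27 28 29 20 21 22 23).newMem (Metric.closedBall c r) m₁) 25 = sSup T ∧
        ∀ i < 24, memAfter (Metric.closedBall c r) (chordCode.drop 5)
        ((Instr.line 30 26 27 28 29 20 21 22 23).newMem (Metric.closedBall c r) m₁) i = m i := by
      set m₂ := (Instr.line 30 26 27 28 29 20 21 22 23).newMem (Metric.closedBall c r) m₁ with hm₂
      have hm₂' : m₂ = write 29 ((pointAt m 20 21 + sSup T • pointAt m 22 23) 1)
          (write 28 ((pointAt m 20 21 + sSup T • pointAt m 22 23) 0)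
          (write 27 ((pointAt m 20 21 + sInf T • pointAt m 22 23) 1)
          (write 26 ((pointAt m 20 21 + sInf T • pointAt m 22 23) 0) (write 30 1 m₁)))) := by
        have hT' := hT
        rw [hTdef, ← hp, ← hp'] at hT'
        simp only [hm₂, Instr.newMem, if_pos hT', hp, hp', ← hTdef]
      have g : ∀ i < 24, m₂ i = m i := by
        intro i hi
        rw [← hlow i hi]
        simp [hm₂', write, Function.update, show i ≠ 26 by omega, show i ≠ 27 by omega,
          show i ≠ 28 by omega, show i ≠ 29 by omega, show i ≠ 30 by omega]
      have g26 : m₂ 26 = m 20 + sInf T * m 22 := by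
        simp [hm₂', write, Function.update, pointAt]
      have g27 : m₂ 27 = m 21 + sInf T * m 23 := by
        simp [hm₂', write, Function.update, pointAt]
      have g28 : m₂ 28 = m 20 + sSup T * m 22 := by
        simp [hm₂', write, Function.update, pointAt]
      have g29 : m₂ 29 = m 21 + sSup T * m 23 := by
        simp [hm₂', write, pointAt]
      obtain ⟨q1, q2, q3⟩ := hrest m₂
      refine ⟨?_, ?_, fun i hi => (q1 i hi).trans (g i hi)⟩
      · rw [q2, g26, g27, g 20 (by norm_num), g 21 (by norm_num), g 22 (by norm_num),
          g 23 (by norm_num), div_eq_iff hN]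
        ring
      · rw [q3, g28, g29, g 20 (by norm_num), g 21 (by norm_num), g 22 (by norm_num),
          g 23 (by norm_num), div_eq_iff hN]
        ring
    refine ⟨e.2.2, fun t => ?_⟩
    rw [e.1, e.2.1, ← Set.mem_Icc, ← hIcc, hiff]
    simp [pointAt]
  -- A missing line leaves the endpoint cells at their presets `p` and `p - d`; these give the
  -- parameters `0` and `-1`, an empty interval, so no separate test is needed.
  · have e : memAfter (Metric.closedBall c r) (chordCode.drop 5)
        ((Instr.line 30 26 27 28 29 20 21 22 23).newMem (Metric.closedBall c r) m₁) 24 = 0 ∧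
        memAfter (Metric.closedBall c r) (chordCode.drop 5)
        ((Instr.line 30 26 27 28 29 20 21 22 23).newMem (Metric.closedBall c r) m₁) 25 = -1 ∧
        ∀ i < 24, memAfter (Metric.closedBall c r) (chordCode.drop 5)
        ((Instr.line 30 26 27 28 29 20 21 22 23).newMem (Metric.closedBall c r) m₁) i = m i := by
      set m₂ := (Instr.line 30 26 27 28 29 20 21 22 23).newMem (Metric.closedBall c r) m₁ with hm₂
      have hm₂' : m₂ = write 30 0 m₁ := by
        have hT' := hT
        rw [hTdef, ← hp, ← hp'] at hT'
        simp only [hm₂, Instr.newMem, if_neg hT']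
      have g : ∀ i < 24, m₂ i = m i := by
        intro i hi
        rw [← hlow i hi]
        simp [hm₂', write, show i ≠ 30 by omega]
      have g26 : m₂ 26 = m 20 := by simp [hm₂', hm₁, write, Function.update]
      have g27 : m₂ 27 = m 21 := by simp [hm₂', hm₁, write, Function.update]
      have g28 : m₂ 28 = m 20 - m 22 := by simp [hm₂', hm₁, write, Function.update]
      have g29 : m₂ 29 = m 21 - m 23 := by simp [hm₂', hm₁, write, Function.update]
      obtain ⟨q1, q2, q3⟩ := hrest m₂
      refine ⟨?_, ?_, fun i hi => (q1 i hi).trans (g i hi)⟩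
      · rw [q2, g26, g27, g 20 (by norm_num), g 21 (by norm_num)]
        simp
      · rw [q3, g28, g29, g 20 (by norm_num), g 21 (by norm_num), g 22 (by norm_num),
          g 23 (by norm_num), div_eq_iff hN]
        ring
    refine ⟨e.2.2, fun t => ?_⟩
    rw [e.1, e.2.1]
    constructor
    · rintro ⟨h1, h2⟩; linarith
    · intro h
      refine absurd ⟨t, ?_⟩ hT
      rw [hiff]
      simpa [pointAt] using h

/-- Line query through the point with coordinates `m i₀ + m j₀, m i₁ + m j₁`, with direction
`m k₀, m k₁`. -/
def ask (i₀ j₀ i₁ j₁ k₀ k₁ : ℕ) : Prog :=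
  block ([.add 20 i₀ j₀, .add 21 i₁ j₁, .add 22 k₀ 3, .add 23 k₁ 3] ++ chordCode)

theorem memAfter_append (C : Set Plane) (l l' : List Instr) (m : ℕ → ℝ) :
    memAfter C (l ++ l') m = memAfter C l' (memAfter C l m) := by
  induction l generalizing m with
  | nil => rfl
  | cons a l ih => simp [memAfter, ih]

theorem runs_ask {c : Plane} {r : ℝ} (hr : 0 < r) {m : ℕ → ℝ} {o : List Plane}
    {R : ℕ → (ℕ → ℝ) → List Plane → Prop} {i₀ j₀ i₁ j₁ k₀ k₁ : ℕ} (h3 : m 3 = 0)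
    (hi₁ : i₁ < 20) (hj₁ : j₁ < 20) (hk₀ : k₀ < 20) (hk₁ : k₁ < 20)
    (hd : m k₀ ≠ 0 ∨ m k₁ ≠ 0)
    (h : ∀ m' : ℕ → ℝ, (∀ i < 20, m' i = m i) →
      Chord c r (m i₀ + m j₀) (m i₁ + m j₁) (m k₀) (m k₁) (m' 24) (m' 25) → R 24 m' o) :
    Runs (Metric.closedBall c r) (ask i₀ j₀ i₁ j₁ k₀ k₁) m o R := by
  apply runs_block
  set l : List Instr := [.add 20 i₀ j₀, .add 21 i₁ j₁, .add 22 k₀ 3, .add 23 k₁ 3] with hl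
  have ho : outAfter (Metric.closedBall c r) (l ++ chordCode) m = [] := by
    simp [hl, outAfter, chordCode, Instr.newOut]
  have hlen : (l ++ chordCode).length = 24 := rfl
  rw [ho, List.append_nil, hlen, memAfter_append]
  set m₁ := memAfter (Metric.closedBall c r) l m with hm₁
  have n1 : i₁ ≠ 20 := by omega
  have n2 : j₁ ≠ 20 := by omega
  have n3 : k₀ ≠ 20 := by omega
  have n4 : k₀ ≠ 21 := by omega
  have n5 : k₁ ≠ 20 := by omega
  have n6 : k₁ ≠ 21 := by omega
  have n7 : k₁ ≠ 22 := by omega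
  have q0 : m₁ 20 = m i₀ + m j₀ := by
    simp [hm₁, hl, memAfter, Instr.newMem, write, Function.update]
  have q1 : m₁ 21 = m i₁ + m j₁ := by
    simp [hm₁, hl, memAfter, Instr.newMem, write, Function.update, n1, n2]
  have q2 : m₁ 22 = m k₀ := by
    simp [hm₁, hl, memAfter, Instr.newMem, write, Function.update, n3, n4, h3]
  have q3 : m₁ 23 = m k₁ := by
    simp [hm₁, hl, memAfter, Instr.newMem, write, Function.update, n5, n6, n7, h3]
  have q : ∀ i < 20, m₁ i = m i := by
    intro i hi
    have a1 : i ≠ 20 := by omega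
    have a2 : i ≠ 21 := by omega
    have a3 : i ≠ 22 := by omega
    have a4 : i ≠ 23 := by omega
    simp [hm₁, hl, memAfter, Instr.newMem, write, Function.update, a1, a2, a3, a4]
  have q4 := memAfter_chordCode (c := c) hr (m := m₁) (by rw [q 3 (by norm_num), h3])
    (by rwa [q2, q3])
  rw [q0, q1, q2, q3] at q4
  exact h _ (fun i hi => by rw [q4.1 i (by omega), q i hi]) q4.2

end RealRAM

namespace RealRAM

/-! ### The program

Cells `0, 1, 2` are the input; cells `3, 4` hold the constants `0, 1`; cells `5, 6` the current vertex,
`7, 8` the first direction of the current quadrant, `9, 10` its second direction; `11, 12` and `13, 14` a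
basis of the lattice; cell `18` tells whether a vertex has been output. -/

/-- Push the second basis vector as far as possible along the first. -/
def growCode : List Instr :=
  [.floor 16 25, .mul 17 16 11, .add 13 13 17, .mul 17 16 12, .add 14 14 17]

/-- Round the entry parameter of a chord up. -/
def ceilCode : List Instr := [.sub 15 3 24, .floor 15 15, .sub 15 3 15]

/-- Replace the basis `a, b` by `a + (m - 1) b, a + m b`. -/
def stepCode : List Instr :=
  [.sub 17 15 4, .mul 16 17 13, .add 11 11 16, .mul 16 17 14, .add 12 12 16, .add 13 13 11,
    .add 14 14 12]

/-- After the maximal push of `b`, cell `15` receives the entry parameter of the chord through `v +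
a` along `b`, rounded up and raised to at least `1`, and cell `25` its exit parameter. The test `15
≤ 25` of `searchLoop` then asks whether some `v + a + n b` with `n ≥ 1` is in the disk. -/
def prepare : Prog :=
  .seq (ask 5 13 6 14 11 12) <| .seq (block growCode) <| .seq (ask 5 11 6 12 13 14) <|
    .seq (block ceilCode) <| .branch 4 15 .skip (block [.const 15 1])

def searchLoop : Prog := .loop 15 25 (.seq (block stepCode) prepare)

/-- Find the direction of the next edge. -/
def search : Prog :=
  .seq (block [.add 11 7 3, .add 12 8 3, .add 13 9 3, .add 14 10 3]) <| .seq prepare searchLoop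

def moveCode : List Instr :=
  [.floor 16 25, .mul 17 16 13, .add 5 5 17, .mul 17 16 14, .add 6 6 17, .const 18 1, .emit 5 6]

/-- Go to the end of the next edge and output it. -/
def move : Prog := .seq (ask 5 3 6 3 13 14) (block moveCode)

def askExit : Prog := ask 5 3 6 3 9 10

/-- The test compares `1` with the exit parameter from the current vertex along `irot a₀`: it asks
whether that unit step stays in the disk. -/
def quadrantLoop : Prog := .loop 4 25 (.seq search (.seq move askExit))

def turnCode : List Instr :=
  [.add 17 7 3, .add 16 8 3, .add 7 9 3, .add 8 10 3, .sub 9 3 17, .sub 10 3 16]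

/-- Output the ends of all edges with a direction in the current quadrant. -/
def quadrant : Prog := .seq askExit (.seq quadrantLoop (block turnCode))

/-- Output all vertices, starting after the current one. -/
def wrap : Prog :=
  .seq quadrant <| .seq quadrant <| .seq quadrant <| .seq quadrant <|
    .branch 18 3 (block [.emit 5 6]) .skip

/-- Look for the lowest row with a lattice point of the disk among `n` rows, and wrap. -/
def rows : ℕ → Prog
  | 0 => .skip
  | n + 1 => .seq (ask 3 3 6 3 4 3) <| .seq (block [.floor 5 25]) <|
      .branch 24 5 wrap (.seq (block [.add 6 6 4]) (rows n))

/-- The program that outputs the vertices of the discrete hull of a disk. -/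
def hullProgram : Prog :=
  .seq (block [.const 4 1, .const 7 1, .const 10 1, .sub 6 2 1, .floor 6 6, .sub 6 3 6]) (rows 3)

/-! ### Its correctness -/

/-- The lattice point with the given integer coordinates. -/
noncomputable def latticePoint (q : ℤ × ℤ) : Plane := !₂[(q.1 : ℝ), (q.2 : ℝ)]

/-- The main variables of the program. -/
structure Core (v a₀ : ℤ × ℤ) (μ : ℝ) (m : ℕ → ℝ) : Prop where
  zero : m 3 = 0
  one : m 4 = 1
  v1 : m 5 = v.1
  v2 : m 6 = v.2
  a1 : m 7 = a₀.1
  a2 : m 8 = a₀.2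
  b1 : m 9 = (irot a₀).1
  b2 : m 10 = (irot a₀).2
  flag : m 18 = μ

/-- The basis maintained by the search. -/
structure Basis (a b : ℤ × ℤ) (m : ℕ → ℝ) : Prop where
  a1 : m 11 = a.1
  a2 : m 12 = a.2
  b1 : m 13 = b.1
  b2 : m 14 = b.2

theorem Core.congr {v a₀ : ℤ × ℤ} {μ : ℝ} {m m' : ℕ → ℝ} (h : Core v a₀ μ m)
    (hm : ∀ i < 20, m' i = m i) : Core v a₀ μ m' := by
  constructor <;> rw [hm _ (by norm_num)]
  exacts [h.zero, h.one, h.v1, h.v2, h.a1, h.a2, h.b1, h.b2, h.flag]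

theorem Basis.congr {a b : ℤ × ℤ} {m m' : ℕ → ℝ} (h : Basis a b m)
    (hm : ∀ i < 20, m' i = m i) : Basis a b m' := by
  constructor <;> rw [hm _ (by norm_num)]
  exacts [h.a1, h.a2, h.b1, h.b2]

/-- The state of the search after its queries. -/
structure Ready (c : Plane) (r : ℝ) (v a₀ : ℤ × ℤ) (μ : ℝ) (a b : ℤ × ℤ) (m : ℕ → ℝ) : Prop where
  inv : SearchInv c r v a₀ a b
  core : Core v a₀ μ m
  basis : Basis a b m
  next : m 15 ≤ m 25 → ∃ k : ℤ, m 15 = k ∧ 2 ≤ k ∧ InDisk c r (v + (a + k • b)) ∧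
    ∀ n, 1 ≤ n → n < k → ¬ InDisk c r (v + (a + n • b))
  done : ¬ m 15 ≤ m 25 → ∀ n : ℤ, 1 ≤ n → ¬ InDisk c r (v + (a + n • b))

theorem chord_int {c : Plane} {r px py dx dy t₀ t₁ : ℝ} (h : Chord c r px py dx dy t₀ t₁)
    {p d : ℤ × ℤ} (h1 : px = p.1) (h2 : py = p.2) (h3 : dx = d.1) (h4 : dy = d.2) (k : ℤ) :
    t₀ ≤ k ∧ (k : ℝ) ≤ t₁ ↔ InDisk c r (p + k • d) := by
  rw [h k, h1, h2, h3, h4]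
  simp [InDisk]

theorem floor_spec {c : Plane} {r t₀ t₁ : ℝ} {p d : ℤ × ℤ}
    (h : ∀ k : ℤ, t₀ ≤ k ∧ (k : ℝ) ≤ t₁ ↔ InDisk c r (p + k • d)) {k₀ : ℤ}
    (hp : InDisk c r (p + k₀ • d)) :
    k₀ ≤ ⌊t₁⌋ ∧ InDisk c r (p + ⌊t₁⌋ • d) ∧ ¬ InDisk c r (p + (⌊t₁⌋ + 1) • d) := by
  have h0 := (h k₀).2 hp
  have h1 : k₀ ≤ ⌊t₁⌋ := Int.le_floor.2 h0.2
  refine ⟨h1, (h _).1 ⟨h0.1.trans (by exact_mod_cast h1), Int.floor_le t₁⟩, fun h2 => ?_⟩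
  have h3 := ((h _).2 h2).2
  push_cast at h3
  linarith [Int.lt_floor_add_one t₁]

theorem runs_prepare {c : Plane} {r : ℝ} (hr : 0 < r) {v a₀ a b : ℤ × ℤ} {μ : ℝ} {m : ℕ → ℝ}
    {o : List Plane} (hs : SearchInv c r v a₀ a b) (hc : Core v a₀ μ m) (hb : Basis a b m) :
    Runs (Metric.closedBall c r) prepare m o fun t m' o' => t ≤ 58 ∧ o' = o ∧
      ∃ b', idot b b ≤ idot b' b' ∧ Ready c r v a₀ μ a b' m' := by
  have nz : ∀ u w : ℤ × ℤ, icross u w = 1 → ((u.1 : ℝ) ≠ 0 ∨ (u.2 : ℝ) ≠ 0) ∧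
      ((w.1 : ℝ) ≠ 0 ∨ (w.2 : ℝ) ≠ 0) := by
    intro u w h
    constructor
    · by_contra hcon
      push Not at hcon
      have h1 : u.1 = 0 := by exact_mod_cast hcon.1
      have h2 : u.2 = 0 := by exact_mod_cast hcon.2
      simp [icross, h1, h2] at h
    · by_contra hcon
      push Not at hcon
      have h1 : w.1 = 0 := by exact_mod_cast hcon.1
      have h2 : w.2 = 0 := by exact_mod_cast hcon.2
      simp [icross, h1, h2] at h
  apply runs_seq
  apply runs_ask hr hc.zero (by norm_num) (by norm_num) (by norm_num) (by norm_num)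
  · rw [hb.a1, hb.a2]; exact (nz _ _ hs.det).1
  intro m₁ hm₁ hch
  replace hc := hc.congr hm₁
  replace hb' := hb.congr hm₁
  have hch' := chord_int hch (p := v + b) (d := a)
    (by rw [← hm₁ 5 (by norm_num), hc.v1, hb.b1]; simp)
    (by rw [← hm₁ 6 (by norm_num), hc.v2, hb.b2]; simp) hb.a1 hb.a2
  obtain ⟨hk0, hkin, hkout⟩ := floor_spec hch' (k₀ := 0) (by simpa using hs.b_in)
  set k := ⌊m₁ 25⌋ with hk
  rw [add_assoc] at hkin hkout
  have hs' := hs.grow hk0 hkin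
  have hgrow := hs.idot_grow hk0
  apply runs_seq
  apply runs_block
  set m₂ := memAfter (Metric.closedBall c r) growCode m₁ with hm₂
  have ho₂ : outAfter (Metric.closedBall c r) growCode m₁ = [] := by
    simp [growCode, outAfter, Instr.newOut]
  rw [ho₂, List.append_nil]
  have hc₂ : Core v a₀ μ m₂ := by
    constructor <;> simp only [hm₂, growCode, memAfter, Instr.newMem, write, Function.update] <;> simp
    exacts [hc.zero, hc.one, hc.v1, hc.v2, hc.a1, hc.a2, hc.b1, hc.b2, hc.flag]
  have hb₂ : Basis a (b + k • a) m₂ := by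
    constructor <;> simp [hm₂, growCode, memAfter, Instr.newMem, write, Function.update, hb'.a1,
      hb'.a2, hb'.b1, hb'.b2, ← hk]
  clear_value m₂
  generalize hbk : b + k • a = b₂ at *
  apply runs_seq
  apply runs_ask hr hc₂.zero (by norm_num) (by norm_num) (by norm_num) (by norm_num)
  · rw [hb₂.b1, hb₂.b2]; exact (nz _ _ hs'.det).2
  intro m₃ hm₃ hch₃
  have hc₃ := hc₂.congr hm₃
  have hb₃ := hb₂.congr hm₃
  have hch₃' := chord_int hch₃ (p := v + a) (d := b₂)
    (by rw [hc₂.v1, hb₂.a1]; simp)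
    (by rw [hc₂.v2, hb₂.a2]; simp) hb₂.b1 hb₂.b2
  apply runs_seq
  apply runs_block
  set m₄ := memAfter (Metric.closedBall c r) ceilCode m₃ with hm₄
  have ho₄ : outAfter (Metric.closedBall c r) ceilCode m₃ = [] := by
    simp [ceilCode, outAfter, Instr.newOut]
  rw [ho₄, List.append_nil]
  have hc₄ : Core v a₀ μ m₄ := by
    constructor <;> simp only [hm₄, ceilCode, memAfter, Instr.newMem, write, Function.update] <;> simp
    exacts [hc₃.zero, hc₃.one, hc₃.v1, hc₃.v2, hc₃.a1, hc₃.a2, hc₃.b1, hc₃.b2, hc₃.flag]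
  have hb₄ : Basis a b₂ m₄ := by
    constructor <;> simp [hm₄, ceilCode, memAfter, Instr.newMem, write, Function.update, hb₃.a1,
      hb₃.a2, hb₃.b1, hb₃.b2]
  have h15 : m₄ 15 = (⌈m₃ 24⌉ : ℤ) := by
    simp [hm₄, ceilCode, memAfter, Instr.newMem, write, Function.update, hc₃.zero, Int.floor_neg]
  have h25 : m₄ 25 = m₃ 25 := by
    simp [hm₄, ceilCode, memAfter, Instr.newMem, write, Function.update]
  clear_value m₄
  -- By maximality of the push; this excludes `m = 1` and so yields `2 ≤ k` in `Ready`.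
  have hout : ¬ InDisk c r (v + (a + (1 : ℤ) • b₂)) := by
    rw [add_smul, one_smul] at hkout
    have e : v + (a + (1 : ℤ) • b₂) = v + (b + (k • a + a)) := by
      rw [← hbk, one_smul]; abel
    rw [e]; exact hkout
  -- `K` stands for the content of cell `15` in both branches: the rounded entry parameter, or `1`
  -- if that is smaller.
  have hnext : ∀ K : ℤ, 1 ≤ K → ⌈m₃ 24⌉ ≤ K → (1 < K → K = ⌈m₃ 24⌉) → (K : ℝ) ≤ m₃ 25 →
      2 ≤ K ∧ InDisk c r (v + (a + K • b₂)) ∧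
        ∀ n, 1 ≤ n → n < K → ¬ InDisk c r (v + (a + n • b₂)) := by
    intro K hK1 hK2 hK3 hK4
    have hin : InDisk c r (v + (a + K • b₂)) := by
      rw [← add_assoc]
      exact (hch₃' K).1 ⟨Int.ceil_le.1 hK2, hK4⟩
    refine ⟨?_, hin, ?_⟩
    · by_contra hlt
      obtain rfl : K = 1 := by omega
      exact hout hin
    · intro n hn hnK hnin
      rw [← add_assoc] at hnin
      have h1 := ((hch₃' n).2 hnin).1
      have h2 := Int.ceil_le.2 h1
      have h3 := hK3 (by omega)
      omega
  have hdone : ∀ K : ℤ, (1 < K → K = ⌈m₃ 24⌉) → ¬ (K : ℝ) ≤ m₃ 25 →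
      ∀ n : ℤ, 1 ≤ n → ¬ InDisk c r (v + (a + n • b₂)) := by
    intro K hK3 hK4 n hn hnin
    rw [← add_assoc] at hnin
    have h1 := (hch₃' n).2 hnin
    apply hK4
    have h2 := Int.ceil_le.2 h1.1
    have h3 : K ≤ n := by
      by_contra hlt
      have := hK3 (by omega)
      omega
    exact le_trans (by exact_mod_cast h3) h1.2
  apply runs_branch
  · intro hle
    apply runs_skip
    refine ⟨by simp [growCode, ceilCode], rfl, b₂, hgrow, hs', hc₄, hb₄, ?_, ?_⟩
    · intro h
      rw [h15, h25] at h
      rw [hc₄.one, h15] at hle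
      have hle' : 1 ≤ ⌈m₃ 24⌉ := by exact_mod_cast hle
      exact ⟨_, h15, hnext _ hle' le_rfl (fun _ => rfl) h⟩
    · intro h
      rw [h15, h25] at h
      exact hdone _ (fun _ => rfl) h
  · intro hle
    rw [hc₄.one, h15] at hle
    have hle' : ⌈m₃ 24⌉ < 1 := by
      by_contra h
      push Not at h
      exact hle (by exact_mod_cast h)
    apply runs_block
    simp only [outAfter, Instr.newOut, memAfter, Instr.newMem, List.append_nil]
    refine ⟨by simp [growCode, ceilCode], trivial, b₂, hgrow, hs', ?_, ?_, ?_, ?_⟩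
    · constructor <;> simp only [write, Function.update] <;> simp
      exacts [hc₄.zero, hc₄.one, hc₄.v1, hc₄.v2, hc₄.a1, hc₄.a2, hc₄.b1, hc₄.b2, hc₄.flag]
    · constructor <;> simp [write, Function.update, hb₄.a1, hb₄.a2, hb₄.b1, hb₄.b2]
    · intro h
      simp only [write, Function.update] at h ⊢
      simp [h25] at h
      refine ⟨1, by simp, hnext 1 le_rfl hle'.le (fun h => absurd h (lt_irrefl _)) (by simpa using h)⟩
    · intro h
      simp only [write, Function.update] at h
      simp [h25] at h
      exact hdone 1 (fun h => absurd h (lt_irrefl _)) (by simpa using h)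

/-- The number `n` is fuel: every round multiplies `|b|²` by at least `4`, and fuel `0` would
contradict `|b|² ≤ 4 r²`, valid because `v` and `v + b` are in the disk. A round costs `66 = 1 + 7 +
58` steps. -/
theorem runs_searchLoop {c : Plane} {r : ℝ} (hr : 0 < r) {v a₀ : ℤ × ℤ} {μ : ℝ} (n : ℕ) :
    ∀ {a b : ℤ × ℤ} {m : ℕ → ℝ} {o : List Plane}, Ready c r v a₀ μ a b m →
      4 * r ^ 2 < idot b b * 4 ^ n →
      Runs (Metric.closedBall c r) searchLoop m o fun t m' o' => t ≤ 66 * n + 1 ∧ o' = o ∧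
        ∃ a b, SearchInv c r v a₀ a b ∧ Core v a₀ μ m' ∧ Basis a b m' ∧
          ∀ n : ℤ, 1 ≤ n → ¬ InDisk c r (v + (a + n • b)) := by
  induction n with
  | zero =>
    intro a b m o h hn
    exfalso
    have h1 := idot_sub_le h.inv.mem h.inv.b_in
    rw [add_sub_cancel_left] at h1
    rw [pow_zero, mul_one] at hn
    linarith
  | succ n ih =>
    intro a b m o h hn
    apply runs_loop
    · intro hle
      exact ⟨by omega, rfl, a, b, h.inv, h.core, h.basis, h.done hle⟩
    · intro hle
      obtain ⟨k, hk, hk2, hin, hmin⟩ := h.next hle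
      have hinv := h.inv.step (by omega) hin hmin
      have hgrow := h.inv.idot_step hk2
      apply runs_seq
      apply runs_block
      set m₁ := memAfter (Metric.closedBall c r) stepCode m with hm₁
      have ho₁ : outAfter (Metric.closedBall c r) stepCode m = [] := by
        simp [stepCode, outAfter, Instr.newOut]
      rw [ho₁, List.append_nil]
      have hc := h.core
      have hb := h.basis
      have hc₁ : Core v a₀ μ m₁ := by
        constructor <;> simp only [hm₁, stepCode, memAfter, Instr.newMem, write, Function.update] <;>
          simp
        exacts [hc.zero, hc.one, hc.v1, hc.v2, hc.a1, hc.a2, hc.b1, hc.b2, hc.flag]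
      have hb₁ : Basis (a + (k - 1) • b) (a + (k - 1) • b + b) m₁ := by
        constructor <;> simp [hm₁, stepCode, memAfter, Instr.newMem, write, Function.update, hb.a1,
          hb.a2, hb.b1, hb.b2, hk, hc.one] <;> ring
      refine (runs_prepare hr hinv hc₁ hb₁).mono ?_
      rintro t m' o' ⟨ht, rfl, b', hbb, hready⟩
      refine (ih hready ?_).mono ?_
      · have h1 : (4 : ℝ) * idot b b ≤ idot b' b' := by exact_mod_cast hgrow.trans hbb
        calc 4 * r ^ 2 < idot b b * 4 ^ (n + 1) := hn
          _ = (4 * idot b b) * 4 ^ n := by ring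
          _ ≤ idot b' b' * 4 ^ n := by gcongr
      · rintro t' m'' o'' ⟨ht', rfl, hpost⟩
        refine ⟨?_, rfl, hpost⟩
        have : stepCode.length = 7 := rfl
        omega

theorem runs_search {c : Plane} {r : ℝ} (hr : 0 < r) {n : ℕ} (hn : 4 * r ^ 2 < 4 ^ n)
    {v a₀ : ℤ × ℤ} (h0 : idot a₀ a₀ = 1) {μ : ℝ} {m : ℕ → ℝ} {o : List Plane}
    (hs : SearchInv c r v a₀ a₀ (irot a₀)) (hc : Core v a₀ μ m) :
    Runs (Metric.closedBall c r) search m o fun t m' o' => t ≤ 66 * (n + 1) ∧ o' = o ∧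
        ∃ a b, SearchInv c r v a₀ a b ∧ Core v a₀ μ m' ∧ Basis a b m' ∧
          ∀ n : ℤ, 1 ≤ n → ¬ InDisk c r (v + (a + n • b)) := by
  apply runs_seq
  apply runs_block
  simp only [outAfter, Instr.newOut, List.append_nil]
  refine runs_seq ((runs_prepare hr hs (μ := μ) ?_ ?_).mono ?_)
  · constructor <;> simp only [memAfter, Instr.newMem, write, Function.update] <;> simp
    exacts [hc.zero, hc.one, hc.v1, hc.v2, hc.a1, hc.a2, hc.b1, hc.b2, hc.flag]
  · constructor <;> simp [memAfter, Instr.newMem, write, Function.update, hc.a1, hc.a2, hc.b1,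
      hc.b2, hc.zero]
  rintro t m' o' ⟨ht, rfl, b', hbb, hready⟩
  refine (runs_searchLoop hr n hready ?_).mono ?_
  · rw [irot_unit h0] at hbb
    have h1 : (1 : ℝ) ≤ idot b' b' := by exact_mod_cast hbb
    calc 4 * r ^ 2 < 1 * 4 ^ n := by linarith
      _ ≤ idot b' b' * 4 ^ n := by gcongr
  · rintro t' m'' o'' ⟨ht', rfl, hpost⟩
    refine ⟨?_, rfl, hpost⟩
    simp only [List.length_cons, List.length_nil]
    omega

theorem runs_move {c : Plane} {r : ℝ} (hr : 0 < r) {v a₀ e a b : ℤ × ℤ} (h0 : idot a₀ a₀ = 1)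
    {μ : ℝ} {m : ℕ → ℝ} {o : List Plane} (hs : SearchInv c r v a₀ a b) (hc : Core v a₀ μ m)
    (hb : Basis a b m) (hdone : ∀ n : ℤ, 1 ≤ n → ¬ InDisk c r (v + (a + n • b)))
    (he : Supports c r e v) (e1 : 0 ≤ idot a₀ e) (e2 : 0 ≤ icross a₀ e) :
    Runs (Metric.closedBall c r) move m o fun t m' o' => t = 31 ∧
      ∃ v', QuadrantStep c r a₀ v v' ∧ Core v' a₀ 1 m' ∧ o' = o ++ [latticePoint v'] := by
  have hb0 : (b.1 : ℝ) ≠ 0 ∨ (b.2 : ℝ) ≠ 0 := by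
    by_contra hcon
    push Not at hcon
    have h1 : b.1 = 0 := by exact_mod_cast hcon.1
    have h2 : b.2 = 0 := by exact_mod_cast hcon.2
    have := hs.det
    simp [icross, h1, h2] at this
  apply runs_seq
  apply runs_ask hr hc.zero (by norm_num) (by norm_num) (by norm_num) (by norm_num)
  · rw [hb.b1, hb.b2]; exact hb0
  intro m₁ hm₁ hch
  have hc₁ := hc.congr hm₁
  have hb₁ := hb.congr hm₁
  have hch' := chord_int hch (p := v) (d := b) (by rw [hc.v1, hc.zero, add_zero])
    (by rw [hc.v2, hc.zero, add_zero]) hb.b1 hb.b2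
  obtain ⟨hk0, hkin, hkout⟩ := floor_spec hch' (k₀ := 1) (by simpa using hs.b_in)
  have hsup := hs.supports h0 hdone he e1 e2 hk0 hkout
  have hmem : InQuadrant a₀ (⌊m₁ 25⌋ • b) := by
    obtain ⟨q1, q2⟩ := hs.b_quad
    have g1 : idot a₀ (⌊m₁ 25⌋ • b) = ⌊m₁ 25⌋ * idot a₀ b := by simp [idot]; ring
    have g2 : icross a₀ (⌊m₁ 25⌋ • b) = ⌊m₁ 25⌋ * icross a₀ b := by simp [icross]; ring
    refine ⟨?_, ?_⟩
    · rw [g1]; exact mul_nonneg (by omega) q1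
    · rw [g2]; exact mul_pos (by omega) q2
  apply runs_block
  refine ⟨by simp [moveCode], v + ⌊m₁ 25⌋ • b, ⟨hkin, ?_, ?_⟩, ?_, ?_⟩
  · rw [add_sub_cancel_left]; exact hsup
  · rw [add_sub_cancel_left]; exact hmem
  · constructor <;> simp [moveCode, memAfter, Instr.newMem, write, Function.update, hc₁.zero,
      hc₁.one, hc₁.v1, hc₁.v2, hc₁.a1, hc₁.a2, hc₁.b1, hc₁.b2, hb₁.b1, hb₁.b2]
  · simp [moveCode, outAfter, Instr.newMem, Instr.newOut, write, Function.update, pointAt,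
      latticePoint, hc₁.v1, hc₁.v2, hb₁.b1, hb₁.b2]

/-- What the walk through a quadrant has achieved. -/
structure QuadrantPost (c : Plane) (r : ℝ) (a₀ v v' : ℤ × ℤ) (μ μ' : ℝ) (l : List (ℤ × ℤ)) :
    Prop where
  chain : List.IsChain (QuadrantStep c r a₀) (v :: l)
  last : (v :: l).getLast? = some v'
  mem : InDisk c r v'
  supp : Supports c r (irot a₀) v'
  flag : μ' = if l = [] then μ else 1

/-- `N` serves only for termination: each move raises the coordinate along `irot a₀` by at least
`1`. The running time is charged to the edges found, each paying for a search, a move, an exit query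
and a test. -/
theorem runs_quadrantLoop {c : Plane} {r : ℝ} (hr : 0 < r) {n : ℕ} (hn : 4 * r ^ 2 < 4 ^ n)
    {a₀ : ℤ × ℤ} (h0 : idot a₀ a₀ = 1) (N : ℕ) :
    ∀ {v e : ℤ × ℤ} {μ : ℝ} {m : ℕ → ℝ} {o : List Plane},
      InDisk c r v → Supports c r e v → 0 ≤ idot a₀ e → 0 ≤ icross a₀ e → e ≠ 0 →
      Core v a₀ μ m → (∀ k : ℤ, m 24 ≤ k ∧ (k : ℝ) ≤ m 25 ↔ InDisk c r (v + k • irot a₀)) →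
      (∀ q, InDisk c r q → icross a₀ (q - v) ≤ N) →
      Runs (Metric.closedBall c r) quadrantLoop m o fun t m' o' => ∃ l v' μ',
        QuadrantPost c r a₀ v v' μ μ' l ∧ Core v' a₀ μ' m' ∧ o' = o ++ l.map latticePoint ∧
        t ≤ (l.length + 1) * (66 * (n + 1) + 57) := by
  induction N with
  | zero =>
    intro v e μ m o hv he e1 e2 e0 hc hch hN
    apply runs_loop
    · intro hle
      have hout : ¬ InDisk c r (v + irot a₀) := by
        intro hin
        apply hle
        rw [hc.one]
        have := (hch 1).2 (by simpa using hin)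
        simpa using this.2
      exact ⟨[], v, μ, ⟨by simp, by simp, hv, he.next_quadrant h0 hv e1 e2 e0 hout, by simp⟩, hc,
        by simp, by simp⟩
    · intro hle
      exfalso
      have hin : InDisk c r (v + (1 : ℤ) • irot a₀) := by
        refine (hch 1).1 ⟨?_, by rw [hc.one] at hle; simpa using hle⟩
        have := ((hch 0).2 (by simpa using hv)).1
        push_cast at this ⊢
        linarith
      have h1 := hN _ hin
      rw [add_sub_cancel_left, one_smul, icross_self_irot, h0] at h1
      norm_num at h1
  | succ N ih =>
    intro v e μ m o hv he e1 e2 e0 hc hch hN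
    apply runs_loop
    · intro hle
      have hout : ¬ InDisk c r (v + irot a₀) := by
        intro hin
        apply hle
        rw [hc.one]
        have := (hch 1).2 (by simpa using hin)
        simpa using this.2
      exact ⟨[], v, μ, ⟨by simp, by simp, hv, he.next_quadrant h0 hv e1 e2 e0 hout, by simp⟩, hc,
        by simp, by simp⟩
    · intro hle
      have hin : InDisk c r (v + irot a₀) := by
        have : InDisk c r (v + (1 : ℤ) • irot a₀) := by
          refine (hch 1).1 ⟨?_, by rw [hc.one] at hle; simpa using hle⟩
          have := ((hch 0).2 (by simpa using hv)).1
          push_cast at this ⊢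
          linarith
        rwa [one_smul] at this
      apply runs_seq
      refine (runs_search hr hn h0 (searchInv_start h0 hv he e1 e2 hin) hc).mono ?_
      rintro t₁ m₁ o₁ ⟨ht₁, rfl, a, b, hs, hc₁, hb₁, hdone⟩
      apply runs_seq
      refine (runs_move hr h0 hs hc₁ hb₁ hdone he e1 e2).mono ?_
      rintro t₂ m₂ o₂ ⟨rfl, v', hstep, hc₂, rfl⟩
      apply runs_ask hr hc₂.zero (by norm_num) (by norm_num) (by norm_num) (by norm_num)
      · rw [hc₂.b1, hc₂.b2]
        by_contra hcon
        push Not at hcon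
        have h1 : (irot a₀).1 = 0 := by exact_mod_cast hcon.1
        have h2 : (irot a₀).2 = 0 := by exact_mod_cast hcon.2
        have := irot_unit h0
        simp [idot, h1, h2] at this
      intro m₃ hm₃ hch₃
      have hch₃' := chord_int hch₃ (p := v') (d := irot a₀) (by rw [hc₂.v1, hc₂.zero, add_zero])
        (by rw [hc₂.v2, hc₂.zero, add_zero]) hc₂.b1 hc₂.b2
      refine (ih hstep.1 hstep.2.1 hstep.2.2.1 hstep.2.2.2.le hstep.2.2.ne_zero (hc₂.congr hm₃)
        hch₃' ?_).mono ?_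
      · intro q hq
        have h1 := hN q hq
        have h2 := hstep.2.2.2
        have h3 : icross a₀ (q - v) = icross a₀ (q - v') + icross a₀ (v' - v) := by
          simp [icross]; ring
        push_cast at h1
        omega
      · rintro t₄ m₄ o₄ ⟨l, w, μ', hpost, hc₄, rfl, ht₄⟩
        refine ⟨v' :: l, w, μ', ⟨?_, ?_, hpost.mem, hpost.supp, ?_⟩, hc₄, by simp, ?_⟩
        · rw [List.isChain_cons_cons]; exact ⟨hstep, hpost.chain⟩
        · rw [List.getLast?_cons_cons]; exact hpost.last
        · rw [hpost.flag]; simp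
        · rw [List.length_cons]
          have : (l.length + 1 + 1) * (66 * (n + 1) + 57) =
            (l.length + 1) * (66 * (n + 1) + 57) + (66 * (n + 1) + 57) := by ring
          omega

theorem runs_quadrant {c : Plane} {r : ℝ} (hr : 0 < r) {n : ℕ} (hn : 4 * r ^ 2 < 4 ^ n)
    {a₀ : ℤ × ℤ} (h0 : idot a₀ a₀ = 1) {v : ℤ × ℤ} {μ : ℝ} {m : ℕ → ℝ} {o : List Plane}
    (hv : InDisk c r v) (he : Supports c r a₀ v) (hc : Core v a₀ μ m) :
    Runs (Metric.closedBall c r) quadrant m o fun t m' o' => ∃ l v' μ',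
      QuadrantPost c r a₀ v v' μ μ' l ∧ Core v' (irot a₀) μ' m' ∧ o' = o ++ l.map latticePoint ∧
      t ≤ (l.length + 1) * (66 * (n + 1) + 57) + 30 := by
  have ha0 : a₀ ≠ 0 := by
    rintro rfl
    simp [idot] at h0
  apply runs_seq
  apply runs_ask hr hc.zero (by norm_num) (by norm_num) (by norm_num) (by norm_num)
  · rw [hc.b1, hc.b2]
    by_contra hcon
    push Not at hcon
    have h1 : (irot a₀).1 = 0 := by exact_mod_cast hcon.1
    have h2 : (irot a₀).2 = 0 := by exact_mod_cast hcon.2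
    have := irot_unit h0
    simp [idot, h1, h2] at this
  intro m₁ hm₁ hch
  have hch' := chord_int hch (p := v) (d := irot a₀) (by rw [hc.v1, hc.zero, add_zero])
    (by rw [hc.v2, hc.zero, add_zero]) hc.b1 hc.b2
  apply runs_seq
  -- Any bound on the height of the disk above `v` would do for the fuel; it does not enter the
  -- time.
  refine (runs_quadrantLoop hr hn h0 ⌈4 * r ^ 2⌉₊ hv he (h0 ▸ zero_le_one) (icross_self a₀).ge ha0
    (hc.congr hm₁) hch' ?_).mono ?_
  · intro q hq
    have h1 := idot_sub_le hv hq
    rw [idot_eq_of_unit h0] at h1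
    have h2 : icross a₀ (q - v) ≤ idot a₀ (q - v) * idot a₀ (q - v)
        + icross a₀ (q - v) * icross a₀ (q - v) := by
      nlinarith [Int.le_self_sq (icross a₀ (q - v)), mul_self_nonneg (idot a₀ (q - v))]
    have h3 : (icross a₀ (q - v) : ℝ) ≤ ⌈4 * r ^ 2⌉₊ :=
      le_trans (by exact_mod_cast h2) (h1.trans (Nat.le_ceil _))
    exact_mod_cast h3
  · rintro t₂ m₂ o₂ ⟨l, w, μ', hpost, hc₂, rfl, ht₂⟩
    apply runs_block
    refine ⟨l, w, μ', hpost, ?_, by simp [turnCode, outAfter, Instr.newOut], ?_⟩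
    · constructor <;> simp [turnCode, memAfter, Instr.newMem, write, Function.update, hc₂.zero,
        hc₂.one, hc₂.v1, hc₂.v2, hc₂.a1, hc₂.a2, hc₂.b1, hc₂.b2, hc₂.flag, irot]
    · have : turnCode.length = 6 := rfl
      omega

end RealRAM

/-! ### Joining the four quadrants, finding the start, and the final bounds. -/

namespace RealRAM

theorem isChain_glue {α : Type*} {R : α → α → Prop} {v w : α} {l l' : List α}
    (h : List.IsChain R (v :: l)) (hw : (v :: l).getLast? = some w)
    (h' : List.IsChain R (w :: l')) :
    List.IsChain R (v :: (l ++ l')) ∧ (v :: (l ++ l')).getLast? = (w :: l').getLast? := by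
  induction l generalizing v with
  | nil =>
    obtain rfl : v = w := by simpa using hw
    exact ⟨h', rfl⟩
  | cons q l ih =>
    rw [List.isChain_cons_cons] at h
    rw [List.getLast?_cons_cons] at hw
    obtain ⟨i1, i2⟩ := ih h.2 hw
    rw [List.cons_append, List.isChain_cons_cons, List.getLast?_cons_cons]
    exact ⟨⟨h.1, i1⟩, i2⟩

theorem rel_of_mem_chain {α : Type*} {R : α → α → Prop} (htr : ∀ x y z, R x y → R y z → R x z)
    {v : α} {l : List α} (h : List.IsChain R (v :: l)) : ∀ x ∈ l, R v x := by
  induction l generalizing v with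
  | nil => simp
  | cons q l ih =>
    rw [List.isChain_cons_cons] at h
    intro x hx
    rcases List.mem_cons.1 hx with rfl | hx
    · exact h.1
    · exact htr _ _ _ h.1 (ih h.2 x hx)

theorem rel_last_of_mem_dropLast {α : Type*} {R : α → α → Prop}
    (htr : ∀ x y z, R x y → R y z → R x z) {v w : α} {l : List α} (h : List.IsChain R (v :: l))
    (hw : (v :: l).getLast? = some w) : ∀ x ∈ (v :: l).dropLast, R x w := by
  induction l generalizing v with
  | nil => simp
  | cons q l ih =>
    have h0 := h
    rw [List.isChain_cons_cons] at h
    rw [List.getLast?_cons_cons] at hw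
    intro x hx
    rw [List.dropLast_cons_cons, List.mem_cons] at hx
    rcases hx with rfl | hx
    · refine rel_of_mem_chain htr h0 w (List.mem_of_getLast? hw)
    · exact ih h.2 hw x hx

theorem planarCross_latticePoint (u v w z : ℤ × ℤ) :
    planarCross (latticePoint u - latticePoint v) (latticePoint w - latticePoint z) =
      icross (u - v) (w - z) := by
  simp [planarCross, latticePoint, icross]

theorem planarDot_latticePoint (u v w z : ℤ × ℤ) :
    planarDot (latticePoint u - latticePoint v) (latticePoint w - latticePoint z) =
      idot (u - v) (w - z) := by
  simp [planarDot, latticePoint, idot]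

theorem latticePoint_injective : Function.Injective latticePoint := by
  intro p q h
  have h0 := congrArg (fun q : Plane => q 0) h
  have h1 := congrArg (fun q : Plane => q 1) h
  simp [latticePoint] at h0 h1
  exact Prod.ext h0 h1

theorem mem_lattice_disk_iff {c : Plane} {r : ℝ} (hr : 0 < r) (p : Plane) :
    p ∈ Metric.closedBall c r ∩ integerLattice ↔ ∃ q, InDisk c r q ∧ latticePoint q = p := by
  rw [Set.mem_inter_iff, mem_closedBall_iff hr]
  constructor
  · rintro ⟨h1, h2⟩
    obtain ⟨x, hx⟩ := h2 0
    obtain ⟨y, hy⟩ := h2 1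
    refine ⟨(x, y), ?_, ?_⟩
    · rw [hx, hy] at h1; exact h1
    · ext i; fin_cases i
      · simp [latticePoint, hx]
      · simp [latticePoint, hy]
  · rintro ⟨q, hq, rfl⟩
    refine ⟨by simpa [latticePoint, InDisk] using hq, fun i => ?_⟩
    fin_cases i
    · exact ⟨q.1, by simp [latticePoint]⟩
    · exact ⟨q.2, by simp [latticePoint]⟩

theorem Supports.supportingStep {c : Plane} {r : ℝ} (hr : 0 < r) {p q : ℤ × ℤ}
    (h : Supports c r (q - p) q) :
    SupportingStep (Metric.closedBall c r ∩ integerLattice) (latticePoint p) (latticePoint q) := by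
  intro z hz hne
  obtain ⟨w, hw, rfl⟩ := (mem_lattice_disk_iff hr z).1 hz
  have := h w hw (fun h => hne (by rw [h]))
  rw [LeftOf, planarCross_latticePoint, planarDot_latticePoint]
  exact_mod_cast this

/-- The order of the lattice by rows from below, and from right to left in a row. -/
def RowLT (p q : ℤ × ℤ) : Prop := ILeftOf (1, 0) (q - p)

theorem rowLT_iff (p q : ℤ × ℤ) : RowLT p q ↔ p.2 < q.2 ∨ p.2 = q.2 ∧ q.1 < p.1 := by
  simp only [RowLT, ILeftOf, icross, idot, Prod.fst_sub, Prod.snd_sub]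
  omega

theorem RowLT.trans (x y z : ℤ × ℤ) (h : RowLT x y) (h' : RowLT y z) : RowLT x z := by
  rw [rowLT_iff] at *; omega

theorem rowLT_irrefl (x : ℤ × ℤ) : ¬ RowLT x x := by
  rw [rowLT_iff]; omega

/-- The four walks together list the vertices. -/
theorem isCCWVertexList_of_quadrants {c : Plane} {r : ℝ} (hr : 0 < r) {v₀ v₁ v₂ v₃ v₄ : ℤ × ℤ}
    {μ₁ μ₂ μ₃ μ₄ : ℝ} {l₁ l₂ l₃ l₄ : List (ℤ × ℤ)} (hv : InDisk c r v₀)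
    (hs : Supports c r (1, 0) v₀)
    (p₁ : QuadrantPost c r (1, 0) v₀ v₁ 0 μ₁ l₁)
    (p₂ : QuadrantPost c r (irot (1, 0)) v₁ v₂ μ₁ μ₂ l₂)
    (p₃ : QuadrantPost c r (irot (irot (1, 0))) v₂ v₃ μ₂ μ₃ l₃)
    (p₄ : QuadrantPost c r (irot (irot (irot (1, 0)))) v₃ v₄ μ₃ μ₄ l₄) :
    (μ₄ ≤ 0 → IsCCWVertexList (discreteHull (Metric.closedBall c r)) [latticePoint v₄] ∧
      l₁ ++ (l₂ ++ (l₃ ++ l₄)) = []) ∧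
    (¬ μ₄ ≤ 0 → IsCCWVertexList (discreteHull (Metric.closedBall c r))
      ((l₁ ++ (l₂ ++ (l₃ ++ l₄))).map latticePoint)) := by
  -- Four right angles lead back to the direction `(1, 0)`, so `v₀` and `v₄` are both least in the
  -- order `RowLT`.
  have hv40 : v₄ = v₀ := by
    by_contra hne
    have h1 : RowLT v₀ v₄ := hs v₄ p₄.mem hne
    have h2 : RowLT v₄ v₀ := p₄.supp v₀ hv (Ne.symm hne)
    exact rowLT_irrefl _ (h1.trans _ _ _ h2)
  have mono : ∀ {a₀ v w μ μ' l} {R : ℤ × ℤ → ℤ × ℤ → Prop}, QuadrantPost c r a₀ v w μ μ' l →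
      (∀ p q, QuadrantStep c r a₀ p q → R p q) → List.IsChain R (v :: l) :=
    fun h hR => h.chain.imp hR
  -- The first two quadrants ascend in `RowLT` and the last two descend; so the walk cannot meet
  -- `v₀` again before its end.
  have u₁ : ∀ p q, QuadrantStep c r (1, 0) p q → RowLT p q := by
    rintro p q ⟨-, -, h⟩
    simp only [InQuadrant, idot, icross, Prod.fst_sub, Prod.snd_sub] at h
    rw [rowLT_iff]; omega
  have u₂ : ∀ p q, QuadrantStep c r (irot (1, 0)) p q → RowLT p q := by
    rintro p q ⟨-, -, h⟩
    simp only [InQuadrant, idot, icross, irot, Prod.fst_sub, Prod.snd_sub] at h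
    rw [rowLT_iff]; omega
  have u₃ : ∀ p q, QuadrantStep c r (irot (irot (1, 0))) p q → RowLT q p := by
    rintro p q ⟨-, -, h⟩
    simp only [InQuadrant, idot, icross, irot, Prod.fst_sub, Prod.snd_sub] at h
    rw [rowLT_iff]; omega
  have u₄ : ∀ p q, QuadrantStep c r (irot (irot (irot (1, 0)))) p q → RowLT q p := by
    rintro p q ⟨-, -, h⟩
    simp only [InQuadrant, idot, icross, irot, Prod.fst_sub, Prod.snd_sub] at h
    rw [rowLT_iff]; omega
  obtain ⟨up, upl⟩ := isChain_glue (mono p₁ u₁) p₁.last (mono p₂ u₂)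
  rw [p₂.last] at upl
  obtain ⟨down, downl⟩ := isChain_glue (mono p₃ u₃) p₃.last (mono p₄ u₄)
  rw [p₄.last, hv40] at downl
  have st : ∀ a₀ p q, QuadrantStep c r a₀ p q → InDisk c r q ∧ Supports c r (q - p) q :=
    fun _ _ _ h => ⟨h.1, h.2.1⟩
  obtain ⟨s34, -⟩ := isChain_glue (mono p₃ (st _)) p₃.last (mono p₄ (st _))
  obtain ⟨s12, -⟩ := isChain_glue (mono p₁ (st _)) p₁.last (mono p₂ (st _))
  obtain ⟨s, sl⟩ := isChain_glue s12 upl s34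
  rw [downl] at sl
  have upl' := rel_of_mem_chain RowLT.trans up
  have downl' := rel_last_of_mem_dropLast (fun x y z h h' => RowLT.trans z y x h' h) down downl
  rw [List.append_assoc] at s sl
  constructor
  · intro hμ
    have h4 : l₄ = [] := by
      by_contra h; have := p₄.flag; rw [if_neg h] at this; linarith
    have h3 : l₃ = [] := by
      by_contra h
      have := p₄.flag; rw [if_pos h4] at this
      have := p₃.flag; rw [if_neg h] at this; linarith
    have h2 : l₂ = [] := by
      by_contra h
      have := p₄.flag; rw [if_pos h4] at this
      have := p₃.flag; rw [if_pos h3] at this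
      have := p₂.flag; rw [if_neg h] at this; linarith
    have h1 : l₁ = [] := by
      by_contra h
      have := p₄.flag; rw [if_pos h4] at this
      have := p₃.flag; rw [if_pos h3] at this
      have := p₂.flag; rw [if_pos h2] at this
      have := p₁.flag; rw [if_neg h] at this; linarith
    subst h1 h2 h3 h4
    refine ⟨?_, rfl⟩
    rw [hv40]
    have hl := p₁.last
    have e10 : v₀ = v₁ := by simpa using hl
    have e21 : v₁ = v₂ := by simpa using p₂.last
    -- With no edge at all, `v₀` is supported in two opposite directions, so it is the only lattice
    -- point of the disk.
    have hopp := p₂.supp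
    rw [← e21, ← e10] at hopp
    apply isCCWVertexList_of_closed_walk (v₀ := latticePoint v₀)
    · intro v hv'
      rw [List.mem_singleton] at hv'
      rw [mem_lattice_disk_iff hr]
      exact ⟨v₀, hv, hv'.symm⟩
    · rw [List.isChain_pair]
      refine Supports.supportingStep hr ?_
      intro q hq hne
      exfalso
      have h1 := hs q hq hne
      have h2 := hopp q hq hne
      simp only [ILeftOf, icross, idot, irot] at h1 h2
      omega
    · simp
    · simp
  · intro hμ
    have hne : l₁ ++ (l₂ ++ (l₃ ++ l₄)) ≠ [] := by
      intro h
      simp only [List.append_eq_nil_iff] at h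
      obtain ⟨h1, h2, h3, h4⟩ := h
      apply hμ
      rw [p₄.flag, if_pos h4, p₃.flag, if_pos h3, p₂.flag, if_pos h2, p₁.flag, if_pos h1]
    apply isCCWVertexList_of_closed_walk (v₀ := latticePoint v₀)
    · intro v hv'
      rw [List.mem_map] at hv'
      obtain ⟨q, hq, rfl⟩ := hv'
      rw [mem_lattice_disk_iff hr]
      refine ⟨q, ?_, rfl⟩
      simp only [List.mem_append] at hq
      rcases hq with hq | hq | hq | hq
      exacts [inDisk_of_isChain p₁.chain q hq, inDisk_of_isChain p₂.chain q hq,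
        inDisk_of_isChain p₃.chain q hq, inDisk_of_isChain p₄.chain q hq]
    · rw [← List.map_cons, List.isChain_map]
      exact s.imp fun p q h => Supports.supportingStep hr h.2
    · rw [List.getLast?_map]
      rw [List.getLast?_cons, List.getLast?_eq_some_getLast hne] at sl
      rw [List.getLast?_eq_some_getLast hne]
      simp only [Option.getD_some, Option.some.injEq] at sl
      rw [sl]; rfl
    · rw [← List.map_dropLast, List.mem_map]
      rintro ⟨x, hx, hxv⟩
      obtain rfl := latticePoint_injective hxv
      rw [← List.append_assoc] at hx
      -- If nothing descends, the dropped last entry belongs to the ascending part.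
      by_cases h34 : l₃ ++ l₄ = []
      · rw [h34, List.append_nil] at hx
        exact rowLT_irrefl _ (upl' x (List.dropLast_subset _ hx))
      · rw [List.dropLast_append_of_ne_nil h34, List.mem_append] at hx
        rcases hx with hx | hx
        · exact rowLT_irrefl _ (upl' x hx)
        · refine rowLT_irrefl _ (downl' x ?_)
          rw [List.dropLast_cons_of_ne_nil h34]
          exact List.mem_cons_of_mem _ hx

theorem runs_wrap {c : Plane} {r : ℝ} (hr : 0 < r) {n : ℕ} (hn : 4 * r ^ 2 < 4 ^ n) {v : ℤ × ℤ}
    {m : ℕ → ℝ} (hv : InDisk c r v) (hs : Supports c r (1, 0) v) (hc : Core v (1, 0) 0 m) :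
    Runs (Metric.closedBall c r) wrap m [] fun t _ o' =>
      IsCCWVertexList (discreteHull (Metric.closedBall c r)) o' ∧
      (t : ℝ) ≤ (52 * (max r 2) ^ (2 / 3 : ℝ) + 4) * (66 * (n + 1) + 57) + 122 := by
  have i₁ : idot (1, 0) (1, 0) = 1 := by decide
  have i₂ := irot_unit i₁
  have i₃ := irot_unit i₂
  have i₄ := irot_unit i₃
  apply runs_seq
  refine (runs_quadrant hr hn i₁ hv hs hc).mono ?_
  rintro t₁ m₁ o₁ ⟨l₁, v₁, μ₁, p₁, c₁, rfl, ht₁⟩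
  apply runs_seq
  refine (runs_quadrant hr hn i₂ p₁.mem p₁.supp c₁).mono ?_
  rintro t₂ m₂ o₂ ⟨l₂, v₂, μ₂, p₂, c₂, rfl, ht₂⟩
  apply runs_seq
  refine (runs_quadrant hr hn i₃ p₂.mem p₂.supp c₂).mono ?_
  rintro t₃ m₃ o₃ ⟨l₃, v₃, μ₃, p₃, c₃, rfl, ht₃⟩
  apply runs_seq
  refine (runs_quadrant hr hn i₄ p₃.mem p₃.supp c₃).mono ?_
  rintro t₄ m₄ o₄ ⟨l₄, v₄, μ₄, p₄, c₄, rfl, ht₄⟩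
  have key := isCCWVertexList_of_quadrants hr hv hs p₁ p₂ p₃ p₄
  have b₁ := length_le_of_isChain_quadrantStep hr i₁ hv p₁.chain
  have b₂ := length_le_of_isChain_quadrantStep hr i₂ p₁.mem p₂.chain
  have b₃ := length_le_of_isChain_quadrantStep hr i₃ p₂.mem p₃.chain
  have b₄ := length_le_of_isChain_quadrantStep hr i₄ p₃.mem p₄.chain
  -- Here `52 = 4 · 13`, and `122 = 4 · 30 + 2`, where the `2` covers the final test and the output
  -- of a one-point hull.
  have ht : ∀ t : ℕ, t ≤ 2 → ((t₁ + (t₂ + (t₃ + (t₄ + t))) : ℕ) : ℝ) ≤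
      (52 * (max r 2) ^ (2 / 3 : ℝ) + 4) * (66 * (n + 1) + 57) + 122 := by
    intro t ht
    have h1 : t₁ + (t₂ + (t₃ + (t₄ + t))) ≤
        (l₁.length + l₂.length + l₃.length + l₄.length + 4) * (66 * (n + 1) + 57) + 122 := by
      have : (l₁.length + l₂.length + l₃.length + l₄.length + 4) * (66 * (n + 1) + 57) =
        (l₁.length + 1) * (66 * (n + 1) + 57) + (l₂.length + 1) * (66 * (n + 1) + 57)
        + (l₃.length + 1) * (66 * (n + 1) + 57) + (l₄.length + 1) * (66 * (n + 1) + 57) := by ring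
      omega
    have h2 : ((t₁ + (t₂ + (t₃ + (t₄ + t))) : ℕ) : ℝ) ≤
        ((l₁.length + l₂.length + l₃.length + l₄.length + 4) * (66 * (n + 1) + 57) + 122 : ℕ) := by
      exact_mod_cast h1
    refine h2.trans ?_
    push_cast
    gcongr
    linarith
  apply runs_branch
  · intro hμ
    rw [c₄.flag, c₄.zero] at hμ
    obtain ⟨k1, k2⟩ := key.1 hμ
    simp only [List.append_eq_nil_iff] at k2
    obtain ⟨rfl, rfl, rfl, rfl⟩ := k2
    apply runs_block
    refine ⟨?_, ht _ (by simp)⟩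
    simpa [outAfter, Instr.newOut, pointAt, c₄.v1, c₄.v2, latticePoint] using k1
  · intro hμ
    rw [c₄.flag, c₄.zero] at hμ
    apply runs_skip
    refine ⟨?_, ht _ (by simp)⟩
    simpa using key.2 hμ

theorem isCCWVertexList_empty : IsCCWVertexList (∅ : Set Plane) [] := by
  refine ⟨List.nodup_nil, ?_, fun i => i.elim0⟩
  simp

/-- Only the row of `v` matters. A row meets the disk in a lattice point exactly if its rounded-down
exit parameter is not below its entry parameter; that point is then the rightmost of the lowest row,
hence supported in direction `(1, 0)`. A failed row costs `27` steps. -/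
theorem runs_rows {c : Plane} {r : ℝ} (hr : 0 < r) {n : ℕ} (hn : 4 * r ^ 2 < 4 ^ n) (k : ℕ) :
    ∀ {v : ℤ × ℤ} {m : ℕ → ℝ}, Core v (1, 0) 0 m → (∀ q, InDisk c r q → v.2 ≤ q.2) →
      ((∃ q, InDisk c r q) → ∃ q, InDisk c r q ∧ q.2 < v.2 + k) →
      Runs (Metric.closedBall c r) (rows k) m [] fun t _ o' =>
        IsCCWVertexList (discreteHull (Metric.closedBall c r)) o' ∧
        (t : ℝ) ≤ (52 * (max r 2) ^ (2 / 3 : ℝ) + 4) * (66 * (n + 1) + 57) + 122 + 27 * k := by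
  have hpos : (0 : ℝ) ≤ (52 * (max r 2) ^ (2 / 3 : ℝ) + 4) * (66 * (n + 1) + 57) + 122 := by
    have : (0 : ℝ) ≤ max r 2 := le_max_of_le_right (by norm_num)
    positivity
  induction k with
  | zero =>
    intro v m hc hlow hex
    apply runs_skip
    refine ⟨?_, by push_cast; linarith⟩
    have : Metric.closedBall c r ∩ integerLattice = ∅ := by
      rw [Set.eq_empty_iff_forall_notMem]
      intro p hp
      obtain ⟨q, hq, -⟩ := (mem_lattice_disk_iff hr p).1 hp
      obtain ⟨q', hq', hlt⟩ := hex ⟨q, hq⟩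
      have := hlow q' hq'
      push_cast at hlt
      omega
    rw [discreteHull, this, convexHull_empty]
    exact isCCWVertexList_empty
  | succ k ih =>
    intro v m hc hlow hex
    apply runs_seq
    apply runs_ask hr hc.zero (by norm_num) (by norm_num) (by norm_num) (by norm_num)
    · left; rw [hc.one]; exact one_ne_zero
    intro m₁ hm₁ hch
    have hc₁ := hc.congr hm₁
    have hch' := chord_int hch (p := (0, v.2)) (d := (1, 0)) (by rw [hc.zero]; simp)
      (by rw [hc.v2, hc.zero]; simp) (by rw [hc.one]; simp) (by rw [hc.zero]; simp)
    have hrow : ∀ x : ℤ, m₁ 24 ≤ x ∧ (x : ℝ) ≤ m₁ 25 ↔ InDisk c r (x, v.2) := by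
      intro x
      have := hch' x
      simpa using this
    apply runs_seq
    apply runs_block
    simp only [outAfter, Instr.newOut, memAfter, Instr.newMem, List.append_nil]
    set x := ⌊m₁ 25⌋ with hx
    have hc₂ : Core (x, v.2) (1, 0) 0 (write 5 x m₁) := by
      constructor <;> simp [write, Function.update, hc₁.zero, hc₁.one, hc₁.v2, hc₁.a1, hc₁.a2,
        hc₁.b1, hc₁.b2, hc₁.flag]
    have h24 : write 5 (x : ℝ) m₁ 24 = m₁ 24 := by simp [write]
    apply runs_branch
    · intro hle
      rw [h24, hc₂.v1] at hle
      have hin : InDisk c r (x, v.2) := (hrow x).1 ⟨hle, Int.floor_le _⟩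
      refine (runs_wrap hr hn hin ?_ hc₂).mono ?_
      · intro q hq hne
        have h1 := hlow q hq
        change RowLT (x, v.2) q
        rw [rowLT_iff]
        rcases h1.eq_or_lt with h1 | h1
        · right
          refine ⟨h1, ?_⟩
          have hqx : q.1 ≤ x := Int.le_floor.2 ((hrow q.1).2 (by rw [h1]; exact hq)).2
          refine lt_of_le_of_ne hqx fun h => hne ?_
          exact Prod.ext h h1.symm
        · left; exact h1
      · rintro t m' o' ⟨hccw, ht⟩
        refine ⟨hccw, ?_⟩
        simp only [List.length_cons, List.length_nil]
        push_cast
        have : (0 : ℝ) ≤ k := Nat.cast_nonneg k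
        linarith
    · intro hle
      rw [h24, hc₂.v1] at hle
      have hno : ∀ q, InDisk c r q → v.2 ≠ q.2 := by
        intro q hq h1
        have h2 := (hrow q.1).2 (by rw [h1]; exact hq)
        apply hle
        exact h2.1.trans (by exact_mod_cast Int.le_floor.2 h2.2)
      apply runs_seq
      apply runs_block
      simp only [outAfter, Instr.newOut, memAfter, Instr.newMem, List.append_nil]
      refine (ih (v := (x, v.2 + 1)) ?_ ?_ ?_).mono ?_
      · constructor <;> simp [write, Function.update, hc₁.zero, hc₁.one, hc₁.v2, hc₁.a1, hc₁.a2,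
          hc₁.b1, hc₁.b2, hc₁.flag]
      · intro q hq
        have h1 := hlow q hq
        have h2 := hno q hq
        simp only
        omega
      · intro h
        obtain ⟨q, hq, hlt⟩ := hex h
        refine ⟨q, hq, ?_⟩
        push_cast at hlt
        simp only
        omega
      · rintro t m' o' ⟨hccw, ht⟩
        refine ⟨hccw, ?_⟩
        simp only [List.length_cons, List.length_nil]
        push_cast
        linarith

/-- A disk with a lattice point has one in the lowest three rows of the lattice that meet it. -/
theorem exists_inDisk_low {c : Plane} {r : ℝ} (hr : 0 < r) {q : ℤ × ℤ} (hq : InDisk c r q) :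
    ∃ q', InDisk c r q' ∧ q'.2 < ⌈c 1 - r⌉ + 3 := by
  -- A disk of diameter less than `3` lies within these three rows. A larger one meets the second
  -- row, at height `h ∈ [1, 2)` above its lowest point, in a chord of squared half-length `h (2 r -
  -- h) ≥ 2`, which contains the integer nearest to the center.
  by_cases h : r < 3 / 2
  · refine ⟨q, hq, ?_⟩
    have h1 : (q.2 : ℝ) ≤ c 1 + r := by
      simp only [InDisk, OnDisk] at hq
      nlinarith [sq_nonneg ((q.1 : ℝ) - c 0)]
    have h2 := Int.le_ceil (c 1 - r)
    have h3 : (q.2 : ℝ) < ⌈c 1 - r⌉ + 3 := by linarith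
    exact_mod_cast h3
  · push Not at h
    refine ⟨(round (c 0), ⌈c 1 - r⌉ + 1), ?_, by simp⟩
    have h1 := Int.le_ceil (c 1 - r)
    have h2 := Int.ceil_lt_add_one (c 1 - r)
    have h3 := abs_sub_round (c 0)
    simp only [InDisk, OnDisk]
    push_cast
    generalize (⌈c 1 - r⌉ : ℝ) = y at *
    rw [abs_le] at h3
    have h4 : ((round (c 0) : ℝ) - c 0) ^ 2 ≤ 1 / 4 := by nlinarith
    have h5 : 2 ≤ (y + 1 - c 1 + r) * (2 * r - (y + 1 - c 1 + r)) := by nlinarith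
    nlinarith

theorem inDisk_ge_low {c : Plane} {r : ℝ} (hr : 0 < r) {q : ℤ × ℤ} (hq : InDisk c r q) :
    ⌈c 1 - r⌉ ≤ q.2 := by
  rw [Int.ceil_le]
  simp only [InDisk, OnDisk] at hq
  nlinarith [sq_nonneg ((q.1 : ℝ) - c 0)]

theorem runs_hullProgram {c : Plane} {r : ℝ} (hr : 0 < r) {n : ℕ} (hn : 4 * r ^ 2 < 4 ^ n) :
    Runs (Metric.closedBall c r) hullProgram (diskInput c r).mem [] fun t _ o' =>
      IsCCWVertexList (discreteHull (Metric.closedBall c r)) o' ∧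
      (t : ℝ) ≤ (52 * (max r 2) ^ (2 / 3 : ℝ) + 4) * (66 * (n + 1) + 57) + 209 := by
  apply runs_seq
  apply runs_block
  simp only [outAfter, Instr.newOut, List.append_nil]
  refine (runs_rows hr hn 3 (v := (0, ⌈c 1 - r⌉)) ?_ ?_ ?_).mono ?_
  · have e : -⌊r - c 1⌋ = ⌈c 1 - r⌉ := by rw [← Int.ceil_neg, neg_sub]
    constructor <;> simp [memAfter, Instr.newMem, write, Function.update, diskInput, irot, ← e]
  · exact fun q hq => inDisk_ge_low hr hq
  · rintro ⟨q, hq⟩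
    exact exists_inDisk_low hr hq
  · rintro t m' o' ⟨hccw, ht⟩
    refine ⟨hccw, ?_⟩
    simp only [List.length_cons, List.length_nil]
    push_cast at ht ⊢
    linarith

theorem hullProgram_staticBelow : hullProgram.StaticBelow 33 := by
  simp [hullProgram, rows, wrap, quadrant, quadrantLoop, search, searchLoop, prepare, move, askExit,
    ask, block, chordCode, growCode, ceilCode, stepCode, moveCode, turnCode, Prog.StaticBelow,
    Instr.cells, Finset.insert_subset_iff]

end RealRAM

theorem mainTheorem2 :
    ∃ (P : RealRAM.Prog) (K : ℝ) (S : ℕ),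
      ∀ (c : Plane) (r : ℝ), 0 < r →
        ∃ (t : ℕ) (s : RealRAM.State),
          RealRAM.Exec (Metric.closedBall c r) P (RealRAM.diskInput c r) t s ∧
          IsCCWVertexList (discreteHull (Metric.closedBall c r)) s.out ∧
          (t : ℝ) ≤ K * ((max r 2) ^ (2 / 3 : ℝ) * Real.log (max r 2)) ∧
          s.space ≤ S := by
  -- With `X = ρ^(2/3) ≥ 1` and `L = log ρ ≥ 1/2`, the time is at most `56 X · 510 L + 209`, and
  -- `209 ≤ 418 X L`; so `42000` is generous. The cells used have addresses `0` to `32`.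
  refine ⟨RealRAM.hullProgram, 42000, 33, fun c r hr => ?_⟩
  obtain ⟨n, hn, hlog⟩ := exists_pow_gt r hr
  obtain ⟨t, s, hexec, hccw, ht⟩ := RealRAM.runs_hullProgram hr hn (c := c)
    (RealRAM.diskInput c r) rfl rfl
  refine ⟨t, s, hexec, hccw, ht.trans ?_, ?_⟩
  · have hX : 1 ≤ (max r 2) ^ (2 / 3 : ℝ) :=
      Real.one_le_rpow ((by norm_num : (1 : ℝ) ≤ 2).trans (le_max_right _ _)) (by norm_num)
    have hL : 1 / 2 ≤ Real.log (max r 2) :=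
      (by linarith [Real.log_two_gt_d9] : (1 / 2 : ℝ) ≤ Real.log 2).trans
        (Real.log_le_log (by norm_num) (le_max_right _ _))
    generalize (max r 2) ^ (2 / 3 : ℝ) = X at *
    generalize Real.log (max r 2) = L at *
    have h1 : (66 * ((n : ℝ) + 1) + 57) ≤ 510 * L := by linarith
    have h2 : (52 * X + 4) * (66 * ((n : ℝ) + 1) + 57) ≤ (56 * X) * (510 * L) := by
      have : (0 : ℝ) ≤ n := Nat.cast_nonneg n
      gcongr
      linarith
    nlinarith [mul_nonneg (sub_nonneg.2 hX) (sub_nonneg.2 hL)]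
  · have h := hexec.used_subset RealRAM.hullProgram_staticBelow (by simp [RealRAM.diskInput])
    simpa [RealRAM.State.space] using Finset.card_le_card h
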